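/- **Setting.** Let $n\in\{2,3\}$ and let $\Omega\subset\mathbb R^n$ be open, bounded and convex (for instance with $C^{1,1}$ or polygonal boundary; no boundary regularity is needed). Let $a_{ij},c_0\in L^\infty(\Omega)$ with $c_0\ge 0$, $a_{ij}=a_{ji}$ and $\sum_{i,j}a_{ij}(x)\xi_i\xi_j\ge\theta|\xi|^2$ for some $\theta>0$, almost all $x\in\Omega$ and all $\xi\in\mathbb R^n$, and put $a(y,v)=\int_\Omega\big(\sum_{i,j}a_{ij}\,\partial_iy\,\partial_jv+c_0yv\big)\,dx$ on $H^1_0(\Omega)$. Let $\mathcal S:H^{-1}(\Omega)\to H^1_0(\Omega)$ be the solution operator, $a(\mathcal SF,v)=\langle F,v\rangle$ for all $v\in H_0^1(\Omega)$, and $\mathcal S^*:H^{-1}(\Omega)\to H^1_0(\Omega)$ its adjoint. Let $y_c,y_d\in L^2(\Omega)$, $\alpha,\beta>0$, $-\infty<a<0<b<\infty$, and $U_{ad}=\{v\in L^2(\Omega): a\le v\le b\text{ a.e.}\}$. Consider $$\min_{u,z\in L^2(\Omega)} f(u)+g(z)\quad\text{s.t. } u=z,$$ $$f(u)=\tfrac12\|\mathcal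 S(u+y_c)-y_d\|_{L^2}^2+\tfrac\alpha4\|u\|_{L^2}^2,\qquad g(z)=\tfrac\alpha4\|z\|_{L^2}^2+\beta\|z\|_{L^1}+\delta_{U_{ad}}(z),$$ where $\delta_{U_{ad}}$ is the indicator function ($0$ on $U_{ad}$, $+\infty$ elsewhere), with the augmented Lagrangian $\mathcal L_\sigma(u,z;\lambda)=f(u)+g(z)+\langle\lambda,u-z\rangle_{L^2}+\frac\sigma2\|u-z\|_{L^2}^2$ and the KKT residual $$R(u,z,\lambda)=\|\nabla f(u)+\lambda\|_{L^2}^2+\operatorname{dist}^2(0,-\lambda+\partial g(z))+\|u-z\|_{L^2}^2 .$$ **Inexact ADMM.** Let $\sigma>0$, $\tau\in(0,\frac{1+\sqrt5}{2})$, $\epsilon_k\ge0$ with $\sum_{k\ge0}\epsilon_k<\infty$, and $(u^0,z^0,\lambda^0)\in L^2(\Omega)\times U_{ad}\times L^2(\Omega)$. For $k\ge0$, $$u^{k+1}=\arg\min_u\ \mathcal L_\sigma(u,z^k;\lambda^k)-\langle\delta^k,u\rangle_{L^2}\ \text{ for some }\delta^k\in L^2(\Omega)\text{ with }\|\delta^k\|_{L^2}\le\epsilon_k,$$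 $$z^{k+1}=\arg\min_z\ \mathcal L_\sigma(u^{k+1},z;\lambda^k),\qquad \lambda^{k+1}=\lambda^k+\tau\sigma(u^{k+1}-z^{k+1}).$$ The associated states and adjoint states are $y^k=\mathcal S(u^k+y_c)$ and $p^k=\mathcal S^*(y_d-y^k)$. **Theorem.** Let $(y^*,u^*,z^*,p^*,\lambda^*)$ be a KKT point, i.e. $y^*=\mathcal S(u^*+y_c)$, $p^*=\mathcal S^*(y_d-y^*)$, $\frac\alpha2u^*-p^*+\lambda^*=0$, $u^*=z^*\in U_{ad}$, and $\langle\frac\alpha2z^*-\lambda^*,\tilde z-z^*\rangle_{L^2}+\beta(\|\tilde z\|_{L^1}-\|z^*\|_{L^1})\ge0$ for all $\tilde z\in U_{ad}$. Then every sequence generated by the inexact ADMM satisfies $$\lim_{k\to\infty}\big\{\|u^k-u^*\|_{L^2}+\|z^k-z^*\|_{L^2}+\|\lambda^k-\lambda^*\|_{L^2}\big\}=0,\qquad \lim_{k\to\infty}\big\{\|y^k-y^*\|_{H^1_0}+\|p^k-p^*\|_{H^1_0}\big\}=0 .$$ Moreover, for given $\Omega$ and given algorithm parameters $\sigma,\tau,(\epsilon_k)$,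 there is a constant $C$ depending only on the initial point $(u^0,z^0,\lambda^0)$ and the optimal solution $(u^*,z^*,\lambda^*)$ such that for all $k\ge1$ $$\min_{1\le i\le k}R(u^i,z^i,\lambda^i)\le\frac Ck,\qquad\text{and}\qquad \lim_{k\to\infty}\Big(k\cdot\min_{1\le i\le k}R(u^i,z^i,\lambda^i)\Big)=0 .$$ -/

import Mathlib

open MeasureTheory Set Filter Topology
open scoped ENNReal ContDiff

noncomputable section

namespace SparseControl

/-- The Euclidean space `ℝⁿ`. -/
abbrev E (n : ℕ) : Type := EuclideanSpace ℝ (Fin n)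

/-- `L²(Ω)`. -/
abbrev L2 {n : ℕ} (Ω : Set (E n)) : Type := Lp ℝ 2 (volume.restrict Ω)

/-- `L²(Ω; ℝⁿ)`. -/
abbrev L2Vec {n : ℕ} (Ω : Set (E n)) : Type := Lp (E n) 2 (volume.restrict Ω)

/-- The space of pairs (function, gradient) in `L²(Ω) × L²(Ω; ℝⁿ)`, with the norm
`(‖y‖² + ‖G‖²)^(1/2)`, i.e. the `H¹` norm. -/
abbrev Pair {n : ℕ} (Ω : Set (E n)) : Type := WithLp 2 (L2 Ω × L2Vec Ω)

/-- The pairs `(φ, ∇φ)` with `φ ∈ C_c^∞(Ω)`. -/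
def testPairs {n : ℕ} (Ω : Set (E n)) : Submodule ℝ (Pair Ω) where
  carrier := {w | ∃ φ : E n → ℝ, ContDiff ℝ ∞ φ ∧ HasCompactSupport φ ∧ tsupport φ ⊆ Ω ∧
    w.fst =ᵐ[volume.restrict Ω] φ ∧ w.snd =ᵐ[volume.restrict Ω] gradient φ}
  zero_mem' := by
    refine ⟨0, contDiff_const, HasCompactSupport.zero, by simp, ?_, ?_⟩
    · exact Lp.coeFn_zero _ _ _
    · have h : gradient (0 : E n → ℝ) = 0 := by
        funext x; simp [gradient]
      rw [h]; exact Lp.coeFn_zero _ _ _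
  add_mem' := by
    rintro v w ⟨φ, h1, h2, h3, h4, h5⟩ ⟨ψ, k1, k2, k3, k4, k5⟩
    refine ⟨φ + ψ, h1.add k1, h2.add k2,
      (tsupport_add φ ψ).trans (union_subset h3 k3), ?_, ?_⟩
    · exact (Lp.coeFn_add v.fst w.fst).trans (h4.add k4)
    · have h : gradient (φ + ψ) = gradient φ + gradient ψ := by
        funext x
        simp [gradient, fderiv_add (h1.differentiable (by simp) x)
          (k1.differentiable (by simp) x)]
      rw [h]; exact (Lp.coeFn_add v.snd w.snd).trans (h5.add k5)
  smul_mem' := by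
    rintro c w ⟨φ, h1, h2, h3, h4, h5⟩
    refine ⟨c • φ, contDiff_const.smul h1, h2.smul_left,
      (closure_mono (Function.support_const_smul_subset c φ)).trans h3, ?_, ?_⟩
    · exact (Lp.coeFn_smul c w.fst).trans (h4.const_smul c)
    · have h : gradient (c • φ) = c • gradient φ := by
        funext x
        simp [gradient, fderiv_const_smul (h1.differentiable (by simp) x)]
      rw [h]; exact (Lp.coeFn_smul c w.snd).trans (h5.const_smul c)

/-- `H¹₀(Ω)`: the closure of `C_c^∞(Ω)` in the `H¹` norm. An element is recorded as the pair
`(y, ∇y)` of an `L²` function and its weak gradient; the norm is the `H¹` norm. -/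
def H10Sub {n : ℕ} (Ω : Set (E n)) : Submodule ℝ (Pair Ω) := (testPairs Ω).topologicalClosure

abbrev H10 {n : ℕ} (Ω : Set (E n)) : Type := H10Sub Ω

/-- `H⁻¹(Ω)`, the topological dual of `H¹₀(Ω)`. -/
abbrev Hm1 {n : ℕ} (Ω : Set (E n)) : Type := StrongDual ℝ (H10 Ω)

/-- The embedding `H¹₀(Ω) → L²(Ω)`. -/
def toL2 {n : ℕ} {Ω : Set (E n)} : H10 Ω →L[ℝ] L2 Ω :=
  (WithLp.fstL 2 ℝ (L2 Ω) (L2Vec Ω)).comp (H10Sub Ω).subtypeL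

/-- The weak gradient of an element of `H¹₀(Ω)`. -/
def grad {n : ℕ} {Ω : Set (E n)} : H10 Ω →L[ℝ] L2Vec Ω :=
  (WithLp.sndL 2 ℝ (L2 Ω) (L2Vec Ω)).comp (H10Sub Ω).subtypeL

/-- The embedding `L²(Ω) → H⁻¹(Ω)`, `w ↦ (v ↦ (w, v)_{L²(Ω)})`. -/
def toHm1 {n : ℕ} {Ω : Set (E n)} (w : L2 Ω) : Hm1 Ω := (innerSL ℝ w).comp toL2

/-- The data of the control problem: the coefficients `a_{ij}`, `c₀` of the operator
`A y = -∑ ∂_j (a_{ij} ∂_i y) + c₀ y`, the functions `y_c`, `y_d ∈ L²(Ω)`, the cost parameters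
`α`, `β` and the control bounds `a = lo`, `b = hi`. -/
structure Problem {n : ℕ} (Ω : Set (E n)) where
  A : Fin n → Fin n → E n → ℝ
  c₀ : E n → ℝ
  yc : L2 Ω
  yd : L2 Ω
  α : ℝ
  β : ℝ
  lo : ℝ
  hi : ℝ

namespace Problem

variable {n : ℕ} {Ω : Set (E n)}

/-- The standing assumptions on the data: bounded coefficients, `c₀ ≥ 0`, symmetry and uniform
ellipticity, and `α, β > 0`, `a < 0 < b`. -/
structure Admissible (P : Problem Ω) : Prop where
  A_bdd : ∀ i j, MemLp (P.A i j) ⊤ (volume.restrict Ω)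
  c₀_bdd : MemLp P.c₀ ⊤ (volume.restrict Ω)
  c₀_nonneg : ∀ᵐ x ∂(volume.restrict Ω), 0 ≤ P.c₀ x
  A_symm : ∀ᵐ x ∂(volume.restrict Ω), ∀ i j, P.A i j x = P.A j i x
  A_elliptic : ∃ θ : ℝ, 0 < θ ∧ ∀ᵐ x ∂(volume.restrict Ω), ∀ ξ : E n,
    θ * ‖ξ‖ ^ 2 ≤ ∑ i, ∑ j, P.A i j x * ξ i * ξ j
  α_pos : 0 < P.α
  β_pos : 0 < P.β
  lo_neg : P.lo < 0
  hi_pos : 0 < P.hi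

/-- The bilinear form of `A`: `∫_Ω (∑_{i,j} a_{ij} ∂_i y ∂_j v + c₀ y v) dx`. -/
def form (P : Problem Ω) (y v : H10 Ω) : ℝ :=
  ∫ x in Ω, ((∑ i, ∑ j, P.A i j x * grad y x i * grad v x j) + P.c₀ x * toL2 y x * toL2 v x)

/-- The solution operator `S : H⁻¹(Ω) → H¹₀(Ω)`: `S F` is the weak solution `y` of `A y = F`,
`y = 0` on `∂Ω`, i.e. the `y ∈ H¹₀(Ω)` with `a(y, v) = F v` for all `v ∈ H¹₀(Ω)`. -/
def S (P : Problem Ω) (F : Hm1 Ω) : H10 Ω :=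
  Classical.epsilon fun y => ∀ v, P.form y v = F v

/-- The adjoint `S* : H⁻¹(Ω) → H¹₀(Ω)` (using reflexivity of `H¹₀(Ω)`): `S* F` is the
`p ∈ H¹₀(Ω)` with `⟨G, p⟩ = ⟨F, S G⟩` for all `G ∈ H⁻¹(Ω)`. -/
def Sadj (P : Problem Ω) (F : Hm1 Ω) : H10 Ω :=
  Classical.epsilon fun p => ∀ G : Hm1 Ω, G p = F (P.S G)

/-- The state `y(u) = S (u + y_c)`. -/
def state (P : Problem Ω) (u : L2 Ω) : H10 Ω := P.S (toHm1 (u + P.yc))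

/-- The adjoint state `S* (y_d - y)`. -/
def adjState (P : Problem Ω) (y : H10 Ω) : H10 Ω := P.Sadj (toHm1 (P.yd - toL2 y))

/-- The admissible set `{v ∈ L²(Ω) | a ≤ v ≤ b a.e. on Ω}`. -/
def Uad (P : Problem Ω) : Set (L2 Ω) :=
  {v | ∀ᵐ x ∂(volume.restrict Ω), P.lo ≤ v x ∧ v x ≤ P.hi}

end Problem

/-- The `L¹(Ω)` norm of an `L²(Ω)` function (`Ω` bounded). -/
def normL1 {n : ℕ} {Ω : Set (E n)} (z : L2 Ω) : ℝ := ∫ x in Ω, |z x|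

namespace Problem

variable {n : ℕ} {Ω : Set (E n)}

/-- The smooth part of the reduced cost. -/
def f (P : Problem Ω) (u : L2 Ω) : ℝ :=
  1 / 2 * ‖toL2 (P.state u) - P.yd‖ ^ 2 + P.α / 4 * ‖u‖ ^ 2

open Classical in
/-- The nonsmooth part, with the indicator function of `Uad`. -/
def g (P : Problem Ω) (z : L2 Ω) : EReal :=
  ((P.α / 4 * ‖z‖ ^ 2 + P.β * normL1 z : ℝ) : EReal) + (if z ∈ P.Uad then 0 else ⊤)

/-- The augmented Lagrangian. -/
def augLag (P : Problem Ω) (σ : ℝ) (u z lam : L2 Ω) : EReal :=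
  (P.f u : EReal) + P.g z + ((inner ℝ lam (u - z) + σ / 2 * ‖u - z‖ ^ 2 : ℝ) : EReal)

/-- The convex subdifferential of `g` in `L²(Ω)`. -/
def subdiffG (P : Problem Ω) (z : L2 Ω) : Set (L2 Ω) :=
  {ξ | ∀ w, P.g z + ((inner ℝ ξ (w - z) : ℝ) : EReal) ≤ P.g w}

/-- The KKT residual
`‖∇f(u) + λ‖² + dist²(0, -λ + ∂g(z)) + ‖u - z‖²`, with values in `[0, ∞]`
(it is `∞` when `∂g(z)` is empty). -/
def R (P : Problem Ω) (u z lam : L2 Ω) : ℝ≥0∞ :=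
  ‖gradient P.f u + lam‖ₑ ^ 2
    + Metric.infEDist 0 ((fun ξ => -lam + ξ) '' P.subdiffG z) ^ 2
    + ‖u - z‖ₑ ^ 2

/-- The KKT system of the problem. -/
structure IsKKT (P : Problem Ω) (y : H10 Ω) (u z : L2 Ω) (p : H10 Ω) (lam : L2 Ω) : Prop where
  state_eq : y = P.state u
  adj_eq : p = P.adjState y
  grad_eq : (P.α / 2) • u - toL2 p + lam = 0
  u_eq_z : u = z
  z_mem : z ∈ P.Uad
  var_ineq : ∀ w ∈ P.Uad,
    0 ≤ inner ℝ ((P.α / 2) • z - lam) (w - z) + P.β * (normL1 w - normL1 z)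

/-- `(u^k, z^k, λ^k)` is generated by the inexact ADMM with penalty parameter `σ`, step length `τ`
and error tolerances `ε_k`. -/
structure IsADMM (P : Problem Ω) (σ τ : ℝ) (ε : ℕ → ℝ) (u z lam : ℕ → L2 Ω) : Prop where
  z_init : z 0 ∈ P.Uad
  u_step : ∀ k, ∃ δ : L2 Ω, ‖δ‖ ≤ ε k ∧
    IsMinOn (fun v => P.augLag σ v (z k) (lam k) - ((inner ℝ δ v : ℝ) : EReal)) univ (u (k + 1))
  z_step : ∀ k, IsMinOn (fun w => P.augLag σ (u (k + 1)) w (lam k)) univ (z (k + 1))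
  lam_step : ∀ k, lam (k + 1) = lam k + (τ * σ) • (u (k + 1) - z (k + 1))

end Problem

end SparseControl

end

open SparseControl

/-!
A Poincaré inequality and Lax–Milgram make `u ↦ ∇f u = (α / 2) u - p` continuous and strongly
monotone, while `∂g` is monotone, so the iteration is an ADMM for the abstract inclusion
`0 ∈ F u + B u` in a Hilbert space. Its energy is
`‖λ - λ*‖² / (τ σ) + σ ‖z - u*‖² + σ A ‖u - z‖²`. Monotonicity of `B` at consecutive iterates
bounds the cross term `⟪z⁺ - z, u⁺ - z⁺⟫` below by `(1 - τ) ⟪z⁺ - z, u - z⟫`, so the energy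
decreases up to summable errors once `(1 - τ)² < A < 2 - τ`; for `τ > 0` such an `A` exists exactly
when `τ` is below the golden ratio. Hence `‖u - z‖²`, `‖z⁺ - z‖²` and `μ ‖u - u*‖²` are summable,
with a bound that does not involve the monotonicity modulus `μ`. The KKT residual is bounded by
these quantities plus `ε_k²`, so it is summable too, and a running minimum of a summable sequence
is `O(1/k)` and `o(1/k)`.
-/

noncomputable section

namespace SparseControl

open scoped InnerProductSpace

section Rates

theorem mul_inf_Icc_le_tsum (R : ℕ → ℝ≥0∞) (m k : ℕ) :
    ((k - m : ℕ) : ℝ≥0∞) * (Finset.Icc 1 k).inf R ≤ ∑' i, R (i + m + 1) := by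
  calc ((k - m : ℕ) : ℝ≥0∞) * (Finset.Icc 1 k).inf R
      = ∑ _i ∈ Finset.range (k - m), (Finset.Icc 1 k).inf R := by
        rw [Finset.sum_const, Finset.card_range, nsmul_eq_mul]
    _ ≤ ∑ i ∈ Finset.range (k - m), R (i + m + 1) :=
        Finset.sum_le_sum fun i hi => Finset.inf_le <| by
          rw [Finset.mem_range] at hi
          rw [Finset.mem_Icc]
          omega
    _ ≤ ∑' i, R (i + m + 1) := ENNReal.sum_le_tsum _

theorem inf_Icc_le_ofReal_div {R : ℕ → ℝ≥0∞} {C : ℝ}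
    (hR : ∑' i, R (i + 1) ≤ ENNReal.ofReal C) {k : ℕ} (hk : 1 ≤ k) :
    (Finset.Icc 1 k).inf R ≤ ENNReal.ofReal (C / k) := by
  have hk0 : (0 : ℝ) < k := by exact_mod_cast hk
  rw [ENNReal.ofReal_div_of_pos hk0, ENNReal.ofReal_natCast,
    ENNReal.le_div_iff_mul_le (.inl (by simpa using hk0.ne'))
      (.inl (ENNReal.natCast_ne_top k)), mul_comm]
  exact (mul_inf_Icc_le_tsum R 0 k).trans hR

theorem tendsto_mul_inf_Icc {R : ℕ → ℝ≥0∞} (hR : ∑' i, R (i + 1) ≠ ⊤) :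
    Tendsto (fun k : ℕ => (k : ℝ≥0∞) * (Finset.Icc 1 k).inf R) atTop (𝓝 0) := by
  have htail : Tendsto (fun k : ℕ => 2 * ∑' i, R (i + k / 2 + 1)) atTop (𝓝 0) := by
    simpa using ENNReal.Tendsto.const_mul
      ((ENNReal.tendsto_sum_nat_add (fun i => R (i + 1)) hR).comp
        (Nat.tendsto_div_const_atTop two_ne_zero)) (.inr ENNReal.ofNat_ne_top)
  refine tendsto_of_tendsto_of_tendsto_of_le_of_le tendsto_const_nhds htail
    (fun _ => zero_le) fun k => ?_
  calc (k : ℝ≥0∞) * (Finset.Icc 1 k).inf R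
      ≤ (2 * (k - k / 2 : ℕ)) * (Finset.Icc 1 k).inf R := by
        gcongr
        exact_mod_cast (by omega : k ≤ 2 * (k - k / 2))
    _ ≤ 2 * ∑' i, R (i + k / 2 + 1) := by
        rw [mul_assoc]
        gcongr
        exact mul_inf_Icc_le_tsum R (k / 2) k

end Rates

section ConvexAnalysis

variable {H : Type*} [NormedAddCommGroup H] [InnerProductSpace ℝ H]

/-- The subgradients at `z` of `φ` restricted to `K`, i.e. the convex subdifferential at `z ∈ K`
of the function equal to `φ` on `K` and to `+∞` elsewhere. -/
def subgradientsOn (K : Set H) (φ : H → ℝ) (z : H) : Set H :=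
  {ξ | ∀ w ∈ K, φ z + ⟪ξ, w - z⟫_ℝ ≤ φ w}

theorem inner_nonneg_of_mem_subgradientsOn {K : Set H} {φ : H → ℝ} {z w ξ ζ : H}
    (hz : z ∈ K) (hw : w ∈ K) (hξ : ξ ∈ subgradientsOn K φ z) (hζ : ζ ∈ subgradientsOn K φ w) :
    0 ≤ ⟪ξ - ζ, z - w⟫_ℝ := by
  have hzw := hξ w hw
  have hwz := hζ z hz
  rw [← neg_sub, inner_neg_right] at hzw
  rw [inner_sub_left]
  linarith

theorem neg_mem_subgradientsOn_of_isMinOn {K : Set H} {φ q : H → ℝ} {z G : H}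
    (hφ : ConvexOn ℝ K φ) (hz : z ∈ K) (hq : HasFDerivAt q (innerSL ℝ G) z)
    (hmin : IsMinOn (fun w => φ w + q w) K z) : -G ∈ subgradientsOn K φ z := by
  intro w hw
  let h (t : ℝ) : ℝ := t * (φ w - φ z) + q (z + t • (w - z))
  have hmin' : IsMinOn h (Icc 0 1) 0 := by
    rintro t ⟨ht0, ht1⟩
    have hcomb : (1 - t) • z + t • w = z + t • (w - z) := by module
    have hconv := hφ.2 hz hw (sub_nonneg.2 ht1) ht0 (sub_add_cancel 1 t)
    have hval := hmin (hφ.1 hz hw (sub_nonneg.2 ht1) ht0 (sub_add_cancel 1 t))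
    rw [hcomb] at hconv hval
    simp only [mem_ofPred_eq, smul_eq_mul] at hconv hval
    simp only [mem_ofPred_eq, h, zero_smul, zero_mul, add_zero, zero_add]
    linarith
  have hderiv : HasDerivAt h (φ w - φ z + ⟪G, w - z⟫_ℝ) 0 := by
    have hline : HasDerivAt (fun t : ℝ => z + t • (w - z)) (w - z) 0 := by
      simpa using ((hasDerivAt_id (0 : ℝ)).smul_const (w - z)).const_add z
    have hq' : HasFDerivAt q (innerSL ℝ G) (z + (0 : ℝ) • (w - z)) := by simpa using hq
    refine (((hasDerivAt_id (0 : ℝ)).mul_const (φ w - φ z)).add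
      (hq'.comp_hasDerivAt 0 hline)).congr_deriv ?_
    rw [one_mul, innerSL_apply_apply]
  have hnonneg := hmin'.localize.hasFDerivWithinAt_nonneg hderiv.hasFDerivAt.hasFDerivWithinAt
    (y := 1 - 0)
    (sub_mem_posTangentConeAt_of_segment_subset (segment_eq_Icc (zero_le_one (α := ℝ))).subset)
  simp only [ContinuousLinearMap.toSpanSingleton_apply, sub_zero, one_smul] at hnonneg
  rw [inner_neg_left]
  linarith

end ConvexAnalysis

section Poincare

section Slab

variable {V : Type*} [NormedAddCommGroup V] [NormedSpace ℝ V] [FiniteDimensional ℝ V]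
  [MeasurableSpace V] [BorelSpace V] {μ : Measure V} [μ.IsAddHaarMeasure] {φ : V → ℝ}

theorem integral_sq_eq_neg_integral_mul_fderiv_mul (hφ : ContDiff ℝ 1 φ)
    (hc : HasCompactSupport φ) {ℓ : V →L[ℝ] ℝ} {e : V} (he : ℓ e = 1) :
    ∫ x, φ x ^ 2 ∂μ = -∫ x, 2 * φ x * fderiv ℝ φ x e * ℓ x ∂μ := by
  have hcont := hφ.continuous
  have := hφ.continuous_fderiv one_ne_zero
  have hdiff := hφ.differentiable one_ne_zero
  have hsq : HasCompactSupport fun x => φ x ^ 2 :=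
    hc.comp_left (g := fun t : ℝ => t ^ 2) (zero_pow two_ne_zero)
  have hfderiv_sq (x v : V) : fderiv ℝ (fun x => φ x ^ 2) x v = 2 * φ x * fderiv ℝ φ x v := by
    rw [((hdiff x).hasFDerivAt.pow 2).fderiv]
    simp
  have hint : Integrable (fun x => 2 * φ x * fderiv ℝ φ x e * ℓ x) μ :=
    Continuous.integrable_of_hasCompactSupport (by fun_prop) hc.mul_left.mul_right.mul_right
  have ibp := integral_mul_fderiv_eq_neg_fderiv_mul_of_integrable (μ := μ) (v := e)
    (f := fun x => φ x ^ 2) (g := ℓ) (by simpa only [hfderiv_sq] using hint)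
    (by
      simp only [ContinuousLinearMap.fderiv]
      exact Continuous.integrable_of_hasCompactSupport (by fun_prop) hsq.mul_right)
    (Continuous.integrable_of_hasCompactSupport (by fun_prop) hsq.mul_right)
    (fun x _ => (hdiff x).pow 2) (fun x _ => ℓ.differentiableAt)
  simpa only [ContinuousLinearMap.fderiv, he, mul_one, hfderiv_sq] using ibp

theorem integral_sq_le_mul_integral_fderiv_sq (hφ : ContDiff ℝ 1 φ) (hc : HasCompactSupport φ)
    {ℓ : V →L[ℝ] ℝ} {e : V} (he : ℓ e = 1) {r : ℝ} (hr : ∀ x, φ x ≠ 0 → |ℓ x| ≤ r) :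
    ∫ x, φ x ^ 2 ∂μ ≤ 4 * r ^ 2 * ∫ x, fderiv ℝ φ x e ^ 2 ∂μ := by
  have hcont := hφ.continuous
  have := hφ.continuous_fderiv one_ne_zero
  have hφ_int : Integrable (fun x => φ x ^ 2) μ :=
    Continuous.integrable_of_hasCompactSupport (by fun_prop)
      (hc.comp_left (g := fun t : ℝ => t ^ 2) (zero_pow two_ne_zero))
  have hfderiv_int : Integrable (fun x => fderiv ℝ φ x e ^ 2) μ :=
    Continuous.integrable_of_hasCompactSupport (by fun_prop)
      ((hc.fderiv_apply ℝ e).comp_left (g := fun t : ℝ => t ^ 2) (zero_pow two_ne_zero))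
  have hprod_int : Integrable (fun x => -(2 * φ x * fderiv ℝ φ x e * ℓ x)) μ :=
    (Continuous.integrable_of_hasCompactSupport (by fun_prop)
      hc.mul_left.mul_right.mul_right).neg
  have hyoung (x : V) : -(2 * φ x * fderiv ℝ φ x e * ℓ x)
      ≤ 1 / 2 * φ x ^ 2 + 2 * r ^ 2 * fderiv ℝ φ x e ^ 2 := by
    rcases eq_or_ne (φ x) 0 with h0 | h0
    · rw [h0]
      have : 0 ≤ 2 * r ^ 2 * fderiv ℝ φ x e ^ 2 := by positivity
      simpa using this
    · have hℓ : fderiv ℝ φ x e ^ 2 * ℓ x ^ 2 ≤ fderiv ℝ φ x e ^ 2 * r ^ 2 :=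
        mul_le_mul_of_nonneg_left (sq_le_sq.2 ((hr x h0).trans (le_abs_self r))) (sq_nonneg _)
      linear_combination 2 * hℓ + 1 / 2 * sq_nonneg (φ x + 2 * (fderiv ℝ φ x e * ℓ x))
  have hmono : ∫ x, φ x ^ 2 ∂μ
      ≤ 1 / 2 * ∫ x, φ x ^ 2 ∂μ + 2 * r ^ 2 * ∫ x, fderiv ℝ φ x e ^ 2 ∂μ :=
    calc ∫ x, φ x ^ 2 ∂μ = ∫ x, -(2 * φ x * fderiv ℝ φ x e * ℓ x) ∂μ := by
          rw [integral_sq_eq_neg_integral_mul_fderiv_mul hφ hc he, integral_neg]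
      _ ≤ ∫ x, (1 / 2 * φ x ^ 2 + 2 * r ^ 2 * fderiv ℝ φ x e ^ 2) ∂μ :=
          integral_mono hprod_int ((hφ_int.const_mul _).add (hfderiv_int.const_mul _)) hyoung
      _ = _ := by
          rw [integral_add (hφ_int.const_mul _) (hfderiv_int.const_mul _), integral_const_mul,
            integral_const_mul]
  linarith

end Slab

theorem Lp_two_norm_sq_eq_integral {X F : Type*} [MeasurableSpace X] {μ : Measure X}
    [NormedAddCommGroup F] [InnerProductSpace ℝ F] (w : Lp F 2 μ) :
    ‖w‖ ^ 2 = ∫ x, ‖w x‖ ^ 2 ∂μ := by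
  rw [← real_inner_self_eq_norm_sq, L2.inner_def]
  simp only [real_inner_self_eq_norm_sq]

theorem Lp_two_norm_sq_eq_integral_of_ae_eq {X F : Type*} [MeasurableSpace X] {μ : Measure X}
    [NormedAddCommGroup F] [InnerProductSpace ℝ F] {s : Set X} {w : Lp F 2 (μ.restrict s)}
    {φ : X → F} (hw : w =ᵐ[μ.restrict s] φ) (hφ : Function.support φ ⊆ s) :
    ‖w‖ ^ 2 = ∫ x, ‖φ x‖ ^ 2 ∂μ := by
  rw [Lp_two_norm_sq_eq_integral,
    ← setIntegral_eq_integral_of_forall_compl_eq_zero (s := s) (f := fun x => ‖φ x‖ ^ 2)]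
  · refine integral_congr_ae ?_
    filter_upwards [hw] with x hx
    rw [hx]
  · intro x hx
    rw [Function.notMem_support.1 fun h => hx (hφ h), norm_zero, zero_pow two_ne_zero]

variable {n : ℕ} {Ω : Set (E n)}

theorem integral_sq_le_mul_integral_norm_gradient_sq (hn : 0 < n) {r : ℝ}
    (hr : ∀ x ∈ Ω, ‖x‖ ≤ r) {φ : E n → ℝ} (hφ : ContDiff ℝ 1 φ) (hc : HasCompactSupport φ)
    (hs : Function.support φ ⊆ Ω) :
    ∫ x, φ x ^ 2 ≤ 4 * r ^ 2 * ∫ x, ‖gradient φ x‖ ^ 2 := by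
  let i : Fin n := ⟨0, hn⟩
  have hnorm (x : E n) : ‖gradient φ x‖ = ‖fderiv ℝ φ x‖ := by simp [gradient]
  have hpartial (x : E n) : fderiv ℝ φ x (EuclideanSpace.single i 1) ^ 2 ≤ ‖gradient φ x‖ ^ 2 := by
    refine sq_le_sq.2 ?_
    rw [hnorm, abs_norm]
    simpa using (fderiv ℝ φ x).le_opNorm (EuclideanSpace.single i 1)
  have := hφ.continuous_fderiv one_ne_zero
  have hpartial_int : Integrable fun x => fderiv ℝ φ x (EuclideanSpace.single i 1) ^ 2 :=
    Continuous.integrable_of_hasCompactSupport (by fun_prop)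
      ((hc.fderiv_apply ℝ _).comp_left (g := fun t : ℝ => t ^ 2) (zero_pow two_ne_zero))
  have hgrad_int : Integrable fun x => ‖gradient φ x‖ ^ 2 := by
    simp only [hnorm]
    exact Continuous.integrable_of_hasCompactSupport (by fun_prop)
      ((hc.fderiv ℝ).norm.comp_left (g := fun t : ℝ => t ^ 2) (zero_pow two_ne_zero))
  refine (integral_sq_le_mul_integral_fderiv_sq hφ hc (ℓ := EuclideanSpace.proj i)
    (e := EuclideanSpace.single i 1) (by simp)
    fun x hx => (PiLp.norm_apply_le x i).trans (hr x (hs hx))).trans ?_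
  exact mul_le_mul_of_nonneg_left (integral_mono hpartial_int hgrad_int hpartial) (by positivity)

theorem exists_norm_toL2_sq_le (hn : 0 < n) (hΩ : Bornology.IsBounded Ω) :
    ∃ c : ℝ, 0 ≤ c ∧ ∀ y : H10 Ω, ‖toL2 y‖ ^ 2 ≤ c * ‖grad y‖ ^ 2 := by
  obtain ⟨r, hr⟩ := hΩ.exists_norm_le
  refine ⟨4 * r ^ 2, by positivity, fun y => ?_⟩
  have hclosed : IsClosed {w : Pair Ω | ‖w.fst‖ ^ 2 ≤ 4 * r ^ 2 * ‖w.snd‖ ^ 2} :=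
    isClosed_le ((WithLp.fstL 2 ℝ (L2 Ω) (L2Vec Ω)).continuous.norm.pow 2)
      (continuous_const.mul ((WithLp.sndL 2 ℝ (L2 Ω) (L2Vec Ω)).continuous.norm.pow 2))
  refine closure_minimal ?_ hclosed y.2
  rintro w ⟨φ, hφ, hc, hs, hfst, hsnd⟩
  have hs_grad : Function.support (gradient φ) ⊆ Ω := fun x hx =>
    hs (support_fderiv_subset ℝ fun h0 => hx (by rw [gradient, h0, map_zero]))
  have hs_φ := (subset_tsupport φ).trans hs
  rw [mem_ofPred_eq, Lp_two_norm_sq_eq_integral_of_ae_eq hfst hs_φ,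
    Lp_two_norm_sq_eq_integral_of_ae_eq hsnd hs_grad]
  simpa only [Real.norm_eq_abs, sq_abs] using integral_sq_le_mul_integral_norm_gradient_sq hn hr
    (hφ.of_le (by norm_cast)) hc hs_φ

end Poincare

section LaxMilgram

variable {V : Type*} [NormedAddCommGroup V] [InnerProductSpace ℝ V] [CompleteSpace V]
  {B : V →L[ℝ] V →L[ℝ] ℝ}

/-- The Lax–Milgram operator of a coercive bilinear form `B`: it sends a functional `F` to the
unique `y` with `B y = F`. -/
def laxMilgram (hB : IsCoercive B) : StrongDual ℝ V →L[ℝ] V :=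
  hB.continuousLinearEquivOfBilin.symm.toContinuousLinearMap ∘L
    (InnerProductSpace.toDual ℝ V).symm.toContinuousLinearEquiv.toContinuousLinearMap

theorem laxMilgram_apply_eq_iff (hB : IsCoercive B) {F : StrongDual ℝ V} {y : V} :
    laxMilgram hB F = y ↔ B y = F := by
  have happly : laxMilgram hB F = hB.continuousLinearEquivOfBilin.symm
      ((InnerProductSpace.toDual ℝ V).symm F) := rfl
  rw [happly, ContinuousLinearEquiv.symm_apply_eq, LinearIsometryEquiv.symm_apply_eq, eq_comm]
  refine Eq.congr_left (ContinuousLinearMap.ext fun v => ?_)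
  rw [InnerProductSpace.toDual_apply_apply, hB.continuousLinearEquivOfBilin_apply]

theorem apply_laxMilgram (hB : IsCoercive B) (F : StrongDual ℝ V) : B (laxMilgram hB F) = F :=
  (laxMilgram_apply_eq_iff hB).1 rfl

theorem apply_laxMilgram_comm (hB : IsCoercive B) (hsymm : ∀ y v, B y v = B v y)
    (F G : StrongDual ℝ V) : F (laxMilgram hB G) = G (laxMilgram hB F) := by
  rw [← apply_laxMilgram hB F, hsymm, apply_laxMilgram, apply_laxMilgram]

end LaxMilgram

section Form

variable {n : ℕ} {Ω : Set (E n)}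

/-- The continuous bilinear form `(f, g) ↦ ∫ b f g` on `L²(Ω)` for `b ∈ L^∞(Ω)`. -/
def weightedPairing {b : E n → ℝ} (hb : MemLp b ⊤ (volume.restrict Ω)) :
    L2 Ω →L[ℝ] L2 Ω →L[ℝ] ℝ :=
  ((ContinuousLinearMap.mul ℝ ℝ).lpPairing (volume.restrict Ω) 2 2).comp
    ((ContinuousLinearMap.mul ℝ ℝ).holderL (volume.restrict Ω) ⊤ 2 2 hb.toLp)

theorem weightedPairing_apply {b : E n → ℝ} (hb : MemLp b ⊤ (volume.restrict Ω)) (f g : L2 Ω) :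
    weightedPairing hb f g = ∫ x in Ω, b x * f x * g x := by
  rw [weightedPairing, ContinuousLinearMap.comp_apply, ContinuousLinearMap.lpPairing_eq_integral]
  refine integral_congr_ae ?_
  filter_upwards [(ContinuousLinearMap.mul ℝ ℝ).coeFn_holder (r := 2) hb.toLp f, hb.coeFn_toLp]
    with x hholder hb_coe
  simp [hholder, hb_coe]

/-- The `i`-th weak partial derivative `H¹₀(Ω) → L²(Ω)`. -/
def weakPartial (i : Fin n) : H10 Ω →L[ℝ] L2 Ω :=
  ((EuclideanSpace.proj i : E n →L[ℝ] ℝ).compLpL 2 (volume.restrict Ω)).comp grad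

theorem coeFn_weakPartial (i : Fin n) (y : H10 Ω) :
    weakPartial i y =ᵐ[volume.restrict Ω] fun x => grad y x i :=
  (EuclideanSpace.proj i : E n →L[ℝ] ℝ).coeFn_compLpL _

theorem memLp_grad_apply (y : H10 Ω) (i : Fin n) :
    MemLp (fun x => grad y x i) 2 (volume.restrict Ω) :=
  (Lp.memLp (weakPartial i y)).ae_eq (coeFn_weakPartial i y)

theorem norm_sq_H10 (y : H10 Ω) : ‖y‖ ^ 2 = ‖toL2 y‖ ^ 2 + ‖grad y‖ ^ 2 :=
  WithLp.prod_norm_sq_eq_of_L2 (y : Pair Ω)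

instance : CompleteSpace (H10 Ω) :=
  (Submodule.isClosed_topologicalClosure (testPairs Ω)).completeSpace_coe

namespace Problem.Admissible

variable {P : Problem Ω}

/-- The bilinear form `Problem.form` as a continuous bilinear map. -/
def formL (hP : P.Admissible) : H10 Ω →L[ℝ] H10 Ω →L[ℝ] ℝ :=
  (∑ i, ∑ j, (weightedPairing (hP.A_bdd i j)).bilinearComp (weakPartial i) (weakPartial j))
    + (weightedPairing hP.c₀_bdd).bilinearComp toL2 toL2

theorem integrable_second_order (hP : P.Admissible) (y v : H10 Ω) (i j : Fin n) :
    Integrable (fun x => P.A i j x * grad y x i * grad v x j) (volume.restrict Ω) :=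
  ((memLp_grad_apply y i).mul (r := 2) (hP.A_bdd i j)).integrable_mul (memLp_grad_apply v j)

theorem integrable_zeroth_order (hP : P.Admissible) (y v : H10 Ω) :
    Integrable (fun x => P.c₀ x * toL2 y x * toL2 v x) (volume.restrict Ω) :=
  ((Lp.memLp (toL2 y)).mul (r := 2) hP.c₀_bdd).integrable_mul (Lp.memLp (toL2 v))

theorem formL_apply (hP : P.Admissible) (y v : H10 Ω) : hP.formL y v = P.form y v := by
  have hA := hP.integrable_second_order y v
  have hA_row (i : Fin n) := integrable_finsetSum Finset.univ fun j _ => hA i j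
  rw [form, integral_add (integrable_finsetSum _ fun i _ => hA_row i)
    (hP.integrable_zeroth_order y v), integral_finsetSum _ fun i _ => hA_row i]
  simp only [formL, _root_.add_apply, _root_.sum_apply, ContinuousLinearMap.bilinearComp_apply,
    weightedPairing_apply]
  congr 1
  refine Finset.sum_congr rfl fun i _ => ?_
  rw [integral_finsetSum _ fun j _ => hA i j]
  refine Finset.sum_congr rfl fun j _ => integral_congr_ae ?_
  filter_upwards [coeFn_weakPartial i y, coeFn_weakPartial j v] with x hy hv
  rw [hy, hv]

theorem formL_comm (hP : P.Admissible) (y v : H10 Ω) : hP.formL y v = hP.formL v y := by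
  rw [hP.formL_apply, hP.formL_apply]
  refine integral_congr_ae ?_
  filter_upwards [hP.A_symm] with x hx
  rw [Finset.sum_comm]
  congr 1
  · refine Finset.sum_congr rfl fun i _ => Finset.sum_congr rfl fun j _ => ?_
    rw [hx j i, mul_right_comm]
  · rw [mul_right_comm]

theorem exists_mul_norm_grad_sq_le_formL (hP : P.Admissible) :
    ∃ θ : ℝ, 0 < θ ∧ ∀ y, θ * ‖grad y‖ ^ 2 ≤ hP.formL y y := by
  obtain ⟨θ, hθ, helliptic⟩ := hP.A_elliptic
  refine ⟨θ, hθ, fun y => ?_⟩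
  rw [hP.formL_apply, form, Lp_two_norm_sq_eq_integral, ← integral_const_mul]
  have hgrad : Integrable (fun x => ‖grad y x‖ ^ 2) (volume.restrict Ω) :=
    (Lp.memLp (grad y)).integrable_norm_pow two_ne_zero
  refine integral_mono_ae (hgrad.const_mul θ) ((integrable_finsetSum _ fun i _ =>
    integrable_finsetSum _ fun j _ => hP.integrable_second_order y y i j).add
      (hP.integrable_zeroth_order y y)) ?_
  filter_upwards [helliptic, hP.c₀_nonneg] with x hx hc₀
  refine (hx (grad y x)).trans (le_add_of_nonneg_right ?_)
  rw [mul_assoc]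
  exact mul_nonneg hc₀ (mul_self_nonneg _)

theorem isCoercive_formL (hP : P.Admissible) (hn : 0 < n) (hΩ : Bornology.IsBounded Ω) :
    IsCoercive hP.formL := by
  obtain ⟨θ, hθ, hform⟩ := hP.exists_mul_norm_grad_sq_le_formL
  obtain ⟨c, hc, hpoincare⟩ := exists_norm_toL2_sq_le hn hΩ
  refine ⟨θ / (c + 1), by positivity, fun y => ?_⟩
  calc θ / (c + 1) * ‖y‖ * ‖y‖ = θ / (c + 1) * (‖toL2 y‖ ^ 2 + ‖grad y‖ ^ 2) := by
        rw [← norm_sq_H10]; ring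
    _ ≤ θ / (c + 1) * (c * ‖grad y‖ ^ 2 + ‖grad y‖ ^ 2) := by gcongr; exact hpoincare y
    _ = θ * ‖grad y‖ ^ 2 := by field_simp
    _ ≤ hP.formL y y := hform y

theorem S_eq_laxMilgram (hP : P.Admissible) (hco : IsCoercive hP.formL) (F : Hm1 Ω) :
    P.S F = laxMilgram hco F := by
  have hsol (y : H10 Ω) : (∀ v, P.form y v = F v) ↔ laxMilgram hco F = y := by
    simp only [laxMilgram_apply_eq_iff, ContinuousLinearMap.ext_iff, hP.formL_apply]
  exact ((hsol _).1 (Classical.epsilon_spec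
    (p := fun y => ∀ v, P.form y v = F v) ⟨_, (hsol _).2 rfl⟩)).symm

theorem Sadj_eq_laxMilgram (hP : P.Admissible) (hco : IsCoercive hP.formL) (F : Hm1 Ω) :
    P.Sadj F = laxMilgram hco F := by
  have hadj (p : H10 Ω) : (∀ G : Hm1 Ω, G p = F (P.S G)) ↔ p = laxMilgram hco F := by
    simp only [hP.S_eq_laxMilgram hco, apply_laxMilgram_comm hco hP.formL_comm F]
    exact (SeparatingDual.eq_iff_forall_dual_eq (R := ℝ)).symm
  exact (hadj _).1 (Classical.epsilon_spec
    (p := fun p => ∀ G : Hm1 Ω, G p = F (P.S G)) ⟨_, (hadj _).2 rfl⟩)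

end Problem.Admissible

end Form

section ADMM

variable {H : Type*} [NormedAddCommGroup H]

/-- The Lyapunov function of the ADMM relative to a KKT pair `(u', lam')`. The primal residual
enters with a weight `A`, which compensates step lengths `τ ≠ 1`. -/
def energy (σ τ A : ℝ) (u' lam' : H) (u z lam : ℕ → H) (k : ℕ) : ℝ :=
  ‖lam k - lam'‖ ^ 2 / (τ * σ) + σ * ‖z k - u'‖ ^ 2 + σ * A * ‖u k - z k‖ ^ 2

/-- The quantity dissipated by the `k`-th step of the ADMM. -/
def dissipation (μ : ℝ) (u' : H) (u z : ℕ → H) (k : ℕ) : ℝ :=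
  ‖u (k + 1) - z (k + 1)‖ ^ 2 + ‖z (k + 1) - z k‖ ^ 2 + μ * ‖u (k + 1) - u'‖ ^ 2

/-- The KKT residual of a triple; it is `∞` when `B z` is empty. -/
def kktResidual (F : H → H) (B : H → Set H) (u z lam : H) : ℝ≥0∞ :=
  ‖F u + lam‖ₑ ^ 2 + Metric.infEDist 0 ((fun ξ => -lam + ξ) '' B z) ^ 2 + ‖u - z‖ₑ ^ 2

theorem energy_nonneg {σ τ A : ℝ} (hσ : 0 ≤ σ) (hτ : 0 ≤ τ) (hA : 0 ≤ A) (u' lam' : H)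
    (u z lam : ℕ → H) (k : ℕ) : 0 ≤ energy σ τ A u' lam' u z lam k := by
  unfold energy; positivity

theorem dissipation_nonneg {μ : ℝ} (hμ : 0 ≤ μ) (u' : H) (u z : ℕ → H) (k : ℕ) :
    0 ≤ dissipation μ u' u z k := by
  unfold dissipation; positivity

theorem norm_sub_le_mul_sqrt_energy {σ τ A : ℝ} (hσ : 0 < σ) (hτ : 0 < τ) (hA : 0 < A)
    (u' lam' : H) (u z lam : ℕ → H) (k : ℕ) :
    ‖u k - u'‖ ≤ √((1 + A⁻¹) / σ) * √(energy σ τ A u' lam' u z lam k) := by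
  rw [← Real.sqrt_mul (by positivity)]
  refine Real.le_sqrt_of_sq_le ?_
  have htri : ‖u k - u'‖ ≤ ‖z k - u'‖ + ‖u k - z k‖ := by
    rw [add_comm]; exact norm_sub_le_norm_sub_add_norm_sub ..
  have hdual : 0 ≤ ‖lam k - lam'‖ ^ 2 / (τ * σ) := by positivity
  calc ‖u k - u'‖ ^ 2 ≤ (‖z k - u'‖ + ‖u k - z k‖) ^ 2 := by gcongr
    _ = (1 + A⁻¹) * (‖z k - u'‖ ^ 2 + A * ‖u k - z k‖ ^ 2)
          - A⁻¹ * (‖z k - u'‖ - A * ‖u k - z k‖) ^ 2 := by field_simp; ring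
    _ ≤ (1 + A⁻¹) * (‖z k - u'‖ ^ 2 + A * ‖u k - z k‖ ^ 2) := sub_le_self _ (by positivity)
    _ = (1 + A⁻¹) / σ * (σ * ‖z k - u'‖ ^ 2 + σ * A * ‖u k - z k‖ ^ 2) := by field_simp
    _ ≤ (1 + A⁻¹) / σ * energy σ τ A u' lam' u z lam k := by
      unfold energy
      gcongr
      linarith

variable [InnerProductSpace ℝ H]

/-- `F` is monotone with modulus `μ`: strongly monotone for `0 < μ`, monotone for `μ = 0`. -/
def IsStronglyMonotone (μ : ℝ) (F : H → H) : Prop :=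
  ∀ u v, μ * ‖u - v‖ ^ 2 ≤ ⟪F u - F v, u - v⟫_ℝ

/-- Monotonicity of a set-valued operator, given by its values `B z`. -/
def IsMonotoneOperator (B : H → Set H) : Prop :=
  ∀ ⦃z w ξ ζ⦄, ξ ∈ B z → ζ ∈ B w → 0 ≤ ⟪ξ - ζ, z - w⟫_ℝ

/-- The inclusion `0 ∈ F u + B u`, split by a multiplier: `F u = -lam` and `lam ∈ B u`. For
`F = ∇f` and `B = ∂g` this is the KKT system of `min f(u) + g(z)` subject to `u = z`. -/
structure IsKKTPair (F : H → H) (B : H → Set H) (u lam : H) : Prop where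
  add_eq_zero : F u + lam = 0
  mem : lam ∈ B u

/-- The error in the optimality condition of the `u`-subproblem. -/
def uError (F : H → H) (σ : ℝ) (u z lam : ℕ → H) (k : ℕ) : H :=
  F (u (k + 1)) + lam k + σ • (u (k + 1) - z k)

/-- The inexact ADMM for `0 ∈ F u + B u`, written through the optimality conditions of its two
subproblems; the first one is solved up to an error of norm at most `ε k`. -/
structure IsInexactADMM (F : H → H) (B : H → Set H) (σ τ : ℝ) (ε : ℕ → ℝ)
    (u z lam : ℕ → H) : Prop where
  norm_uError_le : ∀ k, ‖uError F σ u z lam k‖ ≤ ε k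
  z_step : ∀ k, lam k + σ • (u (k + 1) - z (k + 1)) ∈ B (z (k + 1))
  lam_step : ∀ k, lam (k + 1) = lam k + (τ * σ) • (u (k + 1) - z (k + 1))

theorem admm_energy_identity {σ τ : ℝ} (hσ : σ ≠ 0) (hτ : τ ≠ 0) (z w v l δ : H) :
    ‖l + (τ * σ) • (v - w)‖ ^ 2 / (τ * σ) + σ * ‖w‖ ^ 2
        + 2 * (⟪δ - l - σ • (v - z), v⟫_ℝ + ⟪l + σ • (v - w), w⟫_ℝ)
        + σ * ((2 - τ) * ‖v - w‖ ^ 2 + ‖w - z‖ ^ 2 + 2 * ⟪w - z, v - w⟫_ℝ)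
      = ‖l‖ ^ 2 / (τ * σ) + σ * ‖z‖ ^ 2 + 2 * ⟪δ, v⟫_ℝ := by
  simp only [← real_inner_self_eq_norm_sq, inner_add_left, inner_add_right, inner_sub_left,
    inner_sub_right, real_inner_smul_left, real_inner_smul_right]
  rw [real_inner_comm l v, real_inner_comm l w, real_inner_comm w v, real_inner_comm w z]
  field_simp
  ring

theorem quadratic_form_nonneg {A b c : ℝ} (hA : 0 < A) (h : b ^ 2 ≤ A * c) (r d : H) :
    0 ≤ A * ‖r‖ ^ 2 + 2 * b * ⟪r, d⟫_ℝ + c * ‖d‖ ^ 2 := by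
  have hc : b ^ 2 / A ≤ c := by rwa [div_le_iff₀' hA]
  calc 0 ≤ A * ‖r + (b / A) • d‖ ^ 2 := by positivity
    _ = A * ‖r‖ ^ 2 + 2 * b * ⟪r, d⟫_ℝ + b ^ 2 / A * ‖d‖ ^ 2 := by
      rw [norm_add_sq_real, real_inner_smul_right, norm_smul, mul_pow, Real.norm_eq_abs, sq_abs]
      field_simp
    _ ≤ _ := by gcongr

theorem sq_one_sub_lt_two_sub_of_lt_goldenRatio {τ : ℝ} (hτ : 0 < τ)
    (hτ' : τ < Real.goldenRatio) : (1 - τ) ^ 2 < 2 - τ := by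
  have hroots : 0 < (Real.goldenRatio - τ) * (τ - Real.goldenConj) :=
    mul_pos (sub_pos.2 hτ') (sub_pos.2 (Real.goldenConj_neg.trans hτ))
  linear_combination hroots - Real.goldenRatio_mul_goldenConj + τ * Real.goldenRatio_add_goldenConj

theorem exists_energy_weights {τ : ℝ} (hτ : 0 < τ) (hτ' : τ < Real.goldenRatio) :
    ∃ A η : ℝ, 0 < A ∧ 0 < η ∧ A + η ≤ 2 - τ ∧ (1 - τ) ^ 2 ≤ A * (1 - η) := by
  have hlt := sq_one_sub_lt_two_sub_of_lt_goldenRatio hτ hτ'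
  obtain ⟨A, hsA, hAq⟩ := exists_between hlt
  have hA : 0 < A := (sq_nonneg _).trans_lt hsA
  refine ⟨A, min (2 - τ - A) (1 - (1 - τ) ^ 2 / A), hA, lt_min (by linarith) ?_, ?_, ?_⟩
  · rwa [sub_pos, div_lt_one hA]
  · linarith [min_le_left (2 - τ - A) (1 - (1 - τ) ^ 2 / A)]
  · rw [← div_le_iff₀' hA]
    linarith [min_le_right (2 - τ - A) (1 - (1 - τ) ^ 2 / A)]

theorem add_sum_le_sq_of_perturbed_descent {Ψ D a : ℕ → ℝ} (hΨ : ∀ k, 0 ≤ Ψ k)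
    (hD : ∀ k, 0 ≤ D k) (ha : ∀ k, 0 ≤ a k)
    (h : ∀ k, Ψ (k + 1) + D k ≤ Ψ k + a k * √(Ψ (k + 1))) (N : ℕ) :
    Ψ N + ∑ k ∈ Finset.range N, D k ≤ (√(Ψ 0) + ∑ k ∈ Finset.range N, a k) ^ 2 := by
  have hstep (k : ℕ) : √(Ψ (k + 1)) ≤ √(Ψ k) + a k := by
    have hsq : √(Ψ (k + 1)) ^ 2 ≤ √(Ψ k) ^ 2 + a k * √(Ψ (k + 1)) := by
      rw [Real.sq_sqrt (hΨ _), Real.sq_sqrt (hΨ _)]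
      linarith [h k, hD k]
    by_contra! hlt
    nlinarith [mul_nonneg (ha k) (Real.sqrt_nonneg (Ψ k)), Real.sqrt_nonneg (Ψ k), ha k]
  have hsqrt (N : ℕ) : √(Ψ N) ≤ √(Ψ 0) + ∑ k ∈ Finset.range N, a k := by
    induction N with
    | zero => simp
    | succ N ih => rw [Finset.sum_range_succ]; linarith [hstep N]
  induction N with
  | zero => simp [Real.sq_sqrt (hΨ 0)]
  | succ N ih =>
    rw [Finset.sum_range_succ, Finset.sum_range_succ]
    have hlast := mul_le_mul_of_nonneg_left (hsqrt (N + 1)) (ha N)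
    rw [Finset.sum_range_succ] at hlast
    set s := √(Ψ 0) + ∑ k ∈ Finset.range N, a k
    have hs : 0 ≤ s := (Real.sqrt_nonneg _).trans (hsqrt N)
    nlinarith [h N, mul_nonneg (ha N) hs]

theorem inner_u_residual_le {σ e : ℝ} (hσ : 0 ≤ σ) {z v l δ : H} (hδ : ‖δ‖ ≤ e) :
    ⟪δ - l - σ • (v - z), v⟫_ℝ ≤ (e + ‖l‖ + σ * ‖z‖) * ‖v‖ := by
  have hsplit : ⟪δ - l - σ • (v - z), v⟫_ℝ = ⟪δ - l + σ • z, v⟫_ℝ - σ * ‖v‖ ^ 2 := by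
    rw [← real_inner_self_eq_norm_sq, ← real_inner_smul_left, ← inner_sub_left]
    congr 1
    module
  have hnorm : ‖δ - l + σ • z‖ ≤ e + ‖l‖ + σ * ‖z‖ := by
    refine (norm_add_le _ _).trans ?_
    rw [norm_smul, Real.norm_of_nonneg hσ]
    gcongr
    exact (norm_sub_le _ _).trans (by gcongr)
  calc ⟪δ - l - σ • (v - z), v⟫_ℝ ≤ ⟪δ - l + σ • z, v⟫_ℝ := by
        rw [hsplit]; exact sub_le_self _ (by positivity)
    _ ≤ (e + ‖l‖ + σ * ‖z‖) * ‖v‖ := (real_inner_le_norm _ _).trans (by gcongr)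

theorem add_add_sq_le (a b c : ℝ) : (a + b + c) ^ 2 ≤ 3 * (a ^ 2 + b ^ 2 + c ^ 2) := by
  linarith [sq_nonneg (a - b), sq_nonneg (b - c), sq_nonneg (a - c)]

theorem norm_add_norm_le_of_admm_step {σ e : ℝ} (hσ : 0 < σ) {z w v l δ : H} (hδ : ‖δ‖ ≤ e)
    (hv : 0 ≤ ⟪δ - l - σ • (v - z), v⟫_ℝ) (hw : 0 ≤ ⟪l + σ • (v - w), w⟫_ℝ) :
    ‖v‖ + ‖w‖ ≤ 4 * ((e + ‖l‖ + σ * ‖z‖) / σ) := by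
  have hsum : σ * (‖v‖ ^ 2 - ⟪v, w⟫_ℝ + ‖w‖ ^ 2) ≤ ⟪δ, v⟫_ℝ + ⟪l, w - v⟫_ℝ + σ * ⟪z, v⟫_ℝ := by
    simp only [← real_inner_self_eq_norm_sq, inner_add_left, inner_sub_left, inner_sub_right,
      real_inner_smul_left] at hv hw ⊢
    linarith
  have hδv : ⟪δ, v⟫_ℝ ≤ e * ‖v‖ := (real_inner_le_norm _ _).trans (by gcongr)
  have hlwv : ⟪l, w - v⟫_ℝ ≤ ‖l‖ * (‖v‖ + ‖w‖) :=
    (real_inner_le_norm _ _).trans (by rw [add_comm ‖v‖]; gcongr; exact norm_sub_le _ _)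
  have hzv : σ * ⟪z, v⟫_ℝ ≤ σ * (‖z‖ * ‖v‖) := by gcongr; exact real_inner_le_norm _ _
  have hvw : σ * ⟪v, w⟫_ℝ ≤ σ * (‖v‖ * ‖w‖) := by gcongr; exact real_inner_le_norm _ _
  have hew : 0 ≤ (e + σ * ‖z‖) * ‖w‖ := by
    have := (norm_nonneg δ).trans hδ
    positivity
  have hquad : σ * (‖v‖ + ‖w‖) ^ 2 ≤ 4 * (e + ‖l‖ + σ * ‖z‖) * (‖v‖ + ‖w‖) := by
    linear_combination
      4 * (hsum + hδv + hlwv + hzv + hvw + hew) + 3 * σ * sq_nonneg (‖v‖ - ‖w‖)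
  rcases (add_nonneg (norm_nonneg v) (norm_nonneg w)).eq_or_lt with h0 | hpos
  · rw [← h0]
    have := (norm_nonneg δ).trans hδ
    positivity
  · rw [← mul_div_assoc, le_div_iff₀' hσ]
    refine le_of_mul_le_mul_right ?_ hpos
    linarith

variable {F : H → H} {B : H → Set H} {σ τ μ : ℝ} {ε : ℕ → ℝ} {u z lam : ℕ → H} {u' lam' : H}

namespace IsInexactADMM

theorem tolerance_nonneg (h : IsInexactADMM F B σ τ ε u z lam) (k : ℕ) : 0 ≤ ε k :=
  (norm_nonneg _).trans (h.norm_uError_le k)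

theorem lam_sub_succ (h : IsInexactADMM F B σ τ ε u z lam) (k : ℕ) :
    lam (k + 1) - lam' = lam k - lam' + (τ * σ) • ((u (k + 1) - u') - (z (k + 1) - u')) := by
  rw [h.lam_step, sub_sub_sub_cancel_right]; abel

theorem inner_u_step (hF : IsStronglyMonotone μ F) (hKKT : IsKKTPair F B u' lam') (k : ℕ) :
    μ * ‖u (k + 1) - u'‖ ^ 2 ≤ ⟪uError F σ u z lam k - (lam k - lam')
      - σ • ((u (k + 1) - u') - (z k - u')), u (k + 1) - u'⟫_ℝ := by
  convert hF (u (k + 1)) u' using 2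
  rw [uError, eq_neg_of_add_eq_zero_left hKKT.add_eq_zero, sub_sub_sub_cancel_right]
  abel

theorem inner_z_step (hB : IsMonotoneOperator B) (hKKT : IsKKTPair F B u' lam')
    (h : IsInexactADMM F B σ τ ε u z lam) (k : ℕ) :
    0 ≤ ⟪lam k - lam' + σ • ((u (k + 1) - u') - (z (k + 1) - u')), z (k + 1) - u'⟫_ℝ := by
  convert hB (h.z_step k) hKKT.mem using 2
  rw [sub_sub_sub_cancel_right]
  abel

theorem mul_inner_residual_le (hσ : 0 < σ) (hB : IsMonotoneOperator B)
    (h : IsInexactADMM F B σ τ ε u z lam) (k : ℕ) :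
    (1 - τ) * ⟪u (k + 1) - z (k + 1), z (k + 2) - z (k + 1)⟫_ℝ
      ≤ ⟪z (k + 2) - z (k + 1), u (k + 2) - z (k + 2)⟫_ℝ := by
  have hmono := hB (h.z_step (k + 1)) (h.z_step k)
  have hdiff : lam (k + 1) + σ • (u (k + 2) - z (k + 2)) - (lam k + σ • (u (k + 1) - z (k + 1)))
      = σ • ((u (k + 2) - z (k + 2)) - (1 - τ) • (u (k + 1) - z (k + 1))) := by
    rw [h.lam_step]; module
  rw [hdiff, real_inner_smul_left, inner_sub_left, real_inner_smul_left] at hmono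
  rw [real_inner_comm (u (k + 2) - z (k + 2))]
  linarith [nonneg_of_mul_nonneg_right hmono hσ]

theorem basic_descent (hσ : 0 < σ) (hτ : 0 < τ) (hF : IsStronglyMonotone μ F)
    (hB : IsMonotoneOperator B) (hKKT : IsKKTPair F B u' lam')
    (h : IsInexactADMM F B σ τ ε u z lam) (k : ℕ) :
    ‖lam (k + 1) - lam'‖ ^ 2 / (τ * σ) + σ * ‖z (k + 1) - u'‖ ^ 2
        + 2 * (μ * ‖u (k + 1) - u'‖ ^ 2)
        + σ * ((2 - τ) * ‖u (k + 1) - z (k + 1)‖ ^ 2 + ‖z (k + 1) - z k‖ ^ 2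
          + 2 * ⟪z (k + 1) - z k, u (k + 1) - z (k + 1)⟫_ℝ)
      ≤ ‖lam k - lam'‖ ^ 2 / (τ * σ) + σ * ‖z k - u'‖ ^ 2 + 2 * (ε k * ‖u (k + 1) - u'‖) := by
  have hid := admm_energy_identity hσ.ne' hτ.ne' (z k - u') (z (k + 1) - u') (u (k + 1) - u')
    (lam k - lam') (uError F σ u z lam k)
  rw [← h.lam_sub_succ] at hid
  have hu := inner_u_step (σ := σ) (z := z) (lam := lam) (u := u) hF hKKT k
  have hz := h.inner_z_step hB hKKT k
  have herr : ⟪uError F σ u z lam k, u (k + 1) - u'⟫_ℝ ≤ ε k * ‖u (k + 1) - u'‖ :=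
    (real_inner_le_norm _ _).trans (by gcongr; exact h.norm_uError_le k)
  simp only [sub_sub_sub_cancel_right] at hid hu hz
  linarith

theorem energy_descent {A η : ℝ} (hσ : 0 < σ) (hτ : 0 < τ) (hμ : 0 ≤ μ) (hA : 0 < A)
    (hη : A + η ≤ 2 - τ) (hAη : (1 - τ) ^ 2 ≤ A * (1 - η)) (hF : IsStronglyMonotone μ F)
    (hB : IsMonotoneOperator B) (hKKT : IsKKTPair F B u' lam')
    (h : IsInexactADMM F B σ τ ε u z lam) (k : ℕ) :
    energy σ τ A u' lam' u z lam (k + 2) + min (σ * η) 2 * dissipation μ u' u z (k + 1)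
      ≤ energy σ τ A u' lam' u z lam (k + 1) + 2 * (ε (k + 1) * ‖u (k + 2) - u'‖) := by
  have hdesc := h.basic_descent hσ hτ hF hB hKKT (k + 1)
  have hmono := h.mul_inner_residual_le hσ hB k
  have hform := quadratic_form_nonneg hA hAη (u (k + 1) - z (k + 1)) (z (k + 2) - z (k + 1))
  have hweight := mul_le_mul_of_nonneg_right hη (sq_nonneg ‖u (k + 2) - z (k + 2)‖)
  have hdiss : min (σ * η) 2 * dissipation μ u' u z (k + 1)
      ≤ σ * η * (‖u (k + 2) - z (k + 2)‖ ^ 2 + ‖z (k + 2) - z (k + 1)‖ ^ 2)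
        + 2 * (μ * ‖u (k + 2) - u'‖ ^ 2) := by
    rw [dissipation, mul_add]
    gcongr
    exacts [min_le_left _ _, min_le_right _ _]
  unfold energy
  linear_combination hdesc + hdiss + σ * (2 * hmono + hform + hweight)

/-- The bound is uniform in `μ`: the term `μ * ‖u 1 - u'‖ ^ 2` is controlled by the
`u`-subproblem itself. -/
theorem exists_first_step_bound (hσ : 0 < σ) (hτ : 0 < τ) (ε : ℕ → ℝ) {A : ℝ} (hA : 0 < A) :
    ∃ C : ℝ → ℝ → ℝ, ∀ {F : H → H} {B : H → Set H} {μ : ℝ} {u z lam : ℕ → H} {u' lam' : H},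
      0 ≤ μ → IsStronglyMonotone μ F → IsMonotoneOperator B → IsKKTPair F B u' lam' →
      IsInexactADMM F B σ τ ε u z lam →
      energy σ τ A u' lam' u z lam 1 ≤ C ‖z 0 - u'‖ ‖lam 0 - lam'‖ ∧
        dissipation μ u' u z 0 ≤ C ‖z 0 - u'‖ ‖lam 0 - lam'‖ := by
  let m (s t : ℝ) : ℝ := 4 * ((ε 0 + t + σ * s) / σ)
  refine ⟨fun s t => max
    ((t + τ * σ * m s t) ^ 2 / (τ * σ) + σ * m s t ^ 2 + σ * A * m s t ^ 2)
    (m s t ^ 2 + (m s t + s) ^ 2 + (ε 0 + t + σ * s) * m s t),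
    fun {F B μ u z lam u' lam'} hμ hF hB hKKT h => ?_⟩
  set s := ‖z 0 - u'‖
  set t := ‖lam 0 - lam'‖
  have hu := inner_u_step (σ := σ) (z := z) (lam := lam) (u := u) hF hKKT 0
  have hsum : ‖u 1 - u'‖ + ‖z 1 - u'‖ ≤ m s t :=
    norm_add_norm_le_of_admm_step hσ (h.norm_uError_le 0) ((mul_nonneg hμ (sq_nonneg _)).trans hu)
      (h.inner_z_step hB hKKT 0)
  have hu₁ : ‖u 1 - u'‖ ≤ m s t := by linarith [norm_nonneg (z 1 - u')]
  have hz₁ : ‖z 1 - u'‖ ≤ m s t := by linarith [norm_nonneg (u 1 - u')]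
  have hr₁ : ‖u 1 - z 1‖ ≤ m s t := by
    rw [← sub_sub_sub_cancel_right (u 1) (z 1) u']
    exact (norm_sub_le _ _).trans hsum
  have hd₀ : ‖z 1 - z 0‖ ≤ m s t + s := by
    rw [← sub_sub_sub_cancel_right (z 1) (z 0) u']
    exact (norm_sub_le _ _).trans (by gcongr)
  have hl₁ : ‖lam 1 - lam'‖ ≤ t + τ * σ * m s t := by
    rw [h.lam_sub_succ (u' := u') 0, sub_sub_sub_cancel_right]
    refine (norm_add_le _ _).trans ?_
    rw [norm_smul, Real.norm_of_nonneg (by positivity)]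
    gcongr
  have hμu : μ * ‖u 1 - u'‖ ^ 2 ≤ (ε 0 + t + σ * s) * m s t := by
    refine (hu.trans (inner_u_residual_le hσ.le (h.norm_uError_le 0))).trans ?_
    gcongr
    have := h.tolerance_nonneg 0
    positivity
  refine ⟨le_max_of_le_left ?_, le_max_of_le_right ?_⟩
  · unfold energy; gcongr
  · unfold dissipation; gcongr

theorem exists_dissipation_sum_le (hσ : 0 < σ) (hτ : 0 < τ) (hτ' : τ < Real.goldenRatio)
    (hε : Summable ε) :
    ∃ C : ℝ → ℝ → ℝ, ∀ {F : H → H} {B : H → Set H} {μ : ℝ} {u z lam : ℕ → H} {u' lam' : H},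
      0 ≤ μ → IsStronglyMonotone μ F → IsMonotoneOperator B → IsKKTPair F B u' lam' →
      IsInexactADMM F B σ τ ε u z lam →
      ∀ N, ∑ k ∈ Finset.range N, dissipation μ u' u z k ≤ C ‖z 0 - u'‖ ‖lam 0 - lam'‖ := by
  obtain ⟨A, η, hA, hη, hAη, hsq⟩ := exists_energy_weights hτ hτ'
  obtain ⟨C₁, hC₁⟩ := exists_first_step_bound (H := H) hσ hτ ε hA
  set c := min (σ * η) 2
  have hc : 0 < c := by positivity
  set K := √((1 + A⁻¹) / σ)
  refine ⟨fun s t => C₁ s t + (√(C₁ s t) + ∑' k, 2 * (ε (k + 1) * K)) ^ 2 / c,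
    fun {F B μ u z lam u' lam'} hμ hF hB hKKT h N => ?_⟩
  obtain ⟨henergy, hdiss⟩ := hC₁ hμ hF hB hKKT h
  have hεK (k : ℕ) : 0 ≤ 2 * (ε (k + 1) * K) :=
    mul_nonneg zero_le_two (mul_nonneg (h.tolerance_nonneg _) (Real.sqrt_nonneg _))
  have hεK_sum : Summable fun k => 2 * (ε (k + 1) * K) :=
    (((summable_nat_add_iff 1).2 hε).mul_right K).mul_left 2
  have htail := add_sum_le_sq_of_perturbed_descent
    (Ψ := fun k => energy σ τ A u' lam' u z lam (k + 1))
    (D := fun k => c * dissipation μ u' u z (k + 1))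
    (fun k => energy_nonneg hσ.le hτ.le hA.le u' lam' u z lam (k + 1))
    (fun k => mul_nonneg hc.le (dissipation_nonneg hμ u' u z (k + 1))) hεK
    (fun k => (h.energy_descent hσ hτ hμ hA hAη hsq hF hB hKKT k).trans <| by
      rw [mul_assoc, mul_assoc]
      gcongr
      exacts [h.tolerance_nonneg _, norm_sub_le_mul_sqrt_energy hσ hτ hA ..]) N
  rw [← Finset.mul_sum] at htail
  have hbound : c * ∑ k ∈ Finset.range N, dissipation μ u' u z (k + 1)
      ≤ (√(C₁ ‖z 0 - u'‖ ‖lam 0 - lam'‖) + ∑' k, 2 * (ε (k + 1) * K)) ^ 2 := by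
    refine (le_add_of_nonneg_left (energy_nonneg hσ.le hτ.le hA.le ..)).trans (htail.trans ?_)
    gcongr
    · exact add_nonneg (Real.sqrt_nonneg _) (Finset.sum_nonneg fun k _ => hεK k)
    · exact hεK_sum.sum_le_tsum _ fun k _ => hεK k
  calc ∑ k ∈ Finset.range N, dissipation μ u' u z k
      ≤ ∑ k ∈ Finset.range (N + 1), dissipation μ u' u z k :=
        Finset.sum_le_sum_of_subset_of_nonneg (Finset.range_mono N.le_succ)
          fun k _ _ => dissipation_nonneg hμ u' u z k
    _ = dissipation μ u' u z 0 + ∑ k ∈ Finset.range N, dissipation μ u' u z (k + 1) := by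
        rw [Finset.sum_range_succ', add_comm]
    _ ≤ _ := add_le_add hdiss (by rwa [le_div_iff₀' hc])

theorem summable_dissipation (hσ : 0 < σ) (hτ : 0 < τ) (hτ' : τ < Real.goldenRatio)
    (hε : Summable ε) (hμ : 0 ≤ μ) (hF : IsStronglyMonotone μ F) (hB : IsMonotoneOperator B)
    (hKKT : IsKKTPair F B u' lam') (h : IsInexactADMM F B σ τ ε u z lam) :
    Summable (dissipation μ u' u z) := by
  obtain ⟨C, hC⟩ := exists_dissipation_sum_le (H := H) hσ hτ hτ' hε
  exact summable_of_sum_range_le (dissipation_nonneg hμ u' u z) (hC hμ hF hB hKKT h)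

theorem tendsto (hσ : 0 < σ) (hτ : 0 < τ) (hτ' : τ < Real.goldenRatio) (hε : Summable ε)
    (hμ : 0 < μ) (hF : IsStronglyMonotone μ F) (hFc : ContinuousAt F u')
    (hB : IsMonotoneOperator B) (hKKT : IsKKTPair F B u' lam')
    (h : IsInexactADMM F B σ τ ε u z lam) :
    Tendsto u atTop (𝓝 u') ∧ Tendsto z atTop (𝓝 u') ∧ Tendsto lam atTop (𝓝 lam') := by
  have hdiss := (h.summable_dissipation hσ hτ hτ' hε hμ.le hF hB hKKT).tendsto_atTop_zero
  have hr : Tendsto (fun k => u (k + 1) - z (k + 1)) atTop (𝓝 0) := by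
    refine squeeze_zero_norm' (.of_forall fun k => Real.le_sqrt_of_sq_le ?_)
      (by simpa using hdiss.sqrt)
    have : 0 ≤ ‖z (k + 1) - z k‖ ^ 2 + μ * ‖u (k + 1) - u'‖ ^ 2 := by positivity
    unfold dissipation; linarith
  have hu : Tendsto (fun k => u (k + 1) - u') atTop (𝓝 0) := by
    refine squeeze_zero_norm' (.of_forall fun k => Real.le_sqrt_of_sq_le ?_)
      (by simpa using (hdiss.div_const μ).sqrt)
    have : 0 ≤ ‖u (k + 1) - z (k + 1)‖ ^ 2 + ‖z (k + 1) - z k‖ ^ 2 := by positivity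
    rw [le_div_iff₀' hμ]
    unfold dissipation; linarith
  have hu' : Tendsto (fun k => u (k + 1)) atTop (𝓝 u') := by simpa using hu.add_const u'
  have hz : Tendsto z atTop (𝓝 u') :=
    (tendsto_add_atTop_iff_nat 1).1 (by simpa using hu'.sub hr)
  have herr : Tendsto (uError F σ u z lam) atTop (𝓝 0) :=
    squeeze_zero_norm h.norm_uError_le hε.tendsto_atTop_zero
  have hlam := (herr.sub (hFc.tendsto.comp hu')).sub ((hu'.sub hz).const_smul σ)
  refine ⟨(tendsto_add_atTop_iff_nat 1).1 hu', hz, ?_⟩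
  rw [sub_self, smul_zero, sub_zero, zero_sub, neg_eq_of_add_eq_zero_right hKKT.add_eq_zero]
    at hlam
  refine hlam.congr fun k => ?_
  simp only [uError, Function.comp_apply]
  abel

theorem norm_add_lam_succ_le (h : IsInexactADMM F B σ τ ε u z lam) (k : ℕ) :
    ‖F (u (k + 1)) + lam (k + 1)‖
      ≤ ε k + ‖((1 - τ) * σ) • (u (k + 1) - z (k + 1))‖ + ‖σ • (z (k + 1) - z k)‖ := by
  have hgrad : F (u (k + 1)) + lam (k + 1) = uError F σ u z lam k
      - ((1 - τ) * σ) • (u (k + 1) - z (k + 1)) - σ • (z (k + 1) - z k) := by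
    rw [h.lam_step, uError]
    module
  rw [hgrad]
  refine (norm_sub_le _ _).trans (add_le_add_left ((norm_sub_le _ _).trans ?_) _)
  exact add_le_add_left (h.norm_uError_le k) _

theorem infEDist_neg_lam_succ_add_le (h : IsInexactADMM F B σ τ ε u z lam) (k : ℕ) :
    Metric.infEDist 0 ((fun ξ => -lam (k + 1) + ξ) '' B (z (k + 1)))
      ≤ ‖((1 - τ) * σ) • (u (k + 1) - z (k + 1))‖ₑ := by
  have hmem : ((1 - τ) * σ) • (u (k + 1) - z (k + 1))
      ∈ (fun ξ => -lam (k + 1) + ξ) '' B (z (k + 1)) :=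
    ⟨_, h.z_step k, by rw [h.lam_step]; module⟩
  refine (Metric.infEDist_le_edist_of_mem hmem).trans_eq ?_
  rw [edist_eq_enorm_sub, zero_sub, enorm_neg]

theorem kktResidual_succ_le (hμ : 0 ≤ μ) (u' : H) (h : IsInexactADMM F B σ τ ε u z lam) (k : ℕ) :
    kktResidual F B (u (k + 1)) (z (k + 1)) (lam (k + 1))
      ≤ ENNReal.ofReal ((4 + 4 * ((1 - τ) * σ) ^ 2 + 3 * σ ^ 2)
        * (ε k ^ 2 + dissipation μ u' u z k)) := by
  set r := u (k + 1) - z (k + 1)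
  set d := z (k + 1) - z k
  have hdist := pow_le_pow_left' (h.infEDist_neg_lam_succ_add_le k) 2
  refine (add_le_add_left (add_le_add_right hdist _) _).trans ?_
  simp only [← ofReal_norm, ← ENNReal.ofReal_pow (norm_nonneg _)]
  rw [← ENNReal.ofReal_add (by positivity) (by positivity),
    ← ENNReal.ofReal_add (by positivity) (by positivity)]
  refine ENNReal.ofReal_le_ofReal ?_
  have hrd : ‖r‖ ^ 2 + ‖d‖ ^ 2 ≤ dissipation μ u' u z k := by
    unfold dissipation
    exact le_add_of_nonneg_right (by positivity)
  have hrs : ‖((1 - τ) * σ) • r‖ ^ 2 = ((1 - τ) * σ) ^ 2 * ‖r‖ ^ 2 := by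
    rw [norm_smul, mul_pow, Real.norm_eq_abs, sq_abs]
  have hds : ‖σ • d‖ ^ 2 = σ ^ 2 * ‖d‖ ^ 2 := by
    rw [norm_smul, mul_pow, Real.norm_eq_abs, sq_abs]
  calc ‖F (u (k + 1)) + lam (k + 1)‖ ^ 2 + ‖((1 - τ) * σ) • r‖ ^ 2 + ‖r‖ ^ 2
      ≤ (ε k + ‖((1 - τ) * σ) • r‖ + ‖σ • d‖) ^ 2 + ‖((1 - τ) * σ) • r‖ ^ 2 + ‖r‖ ^ 2 := by
        gcongr
        exact h.norm_add_lam_succ_le k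
    _ ≤ 3 * (ε k ^ 2 + ‖((1 - τ) * σ) • r‖ ^ 2 + ‖σ • d‖ ^ 2) + ‖((1 - τ) * σ) • r‖ ^ 2
          + ‖r‖ ^ 2 := by
        gcongr
        exact add_add_sq_le _ _ _
    _ ≤ (4 + 4 * ((1 - τ) * σ) ^ 2 + 3 * σ ^ 2) * (ε k ^ 2 + (‖r‖ ^ 2 + ‖d‖ ^ 2)) := by
        have : 0 ≤ (1 + 4 * ((1 - τ) * σ) ^ 2 + 3 * σ ^ 2) * ε k ^ 2
          + (3 + 3 * σ ^ 2) * ‖r‖ ^ 2 + (4 + 4 * ((1 - τ) * σ) ^ 2) * ‖d‖ ^ 2 := by positivity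
        rw [hrs, hds]
        linear_combination this
    _ ≤ _ := by gcongr

theorem exists_tsum_kktResidual_le (hσ : 0 < σ) (hτ : 0 < τ) (hτ' : τ < Real.goldenRatio)
    (hε : Summable ε) :
    ∃ C : ℝ → ℝ → ℝ, ∀ {F : H → H} {B : H → Set H} {μ : ℝ} {u z lam : ℕ → H} {u' lam' : H},
      0 ≤ μ → IsStronglyMonotone μ F → IsMonotoneOperator B → IsKKTPair F B u' lam' →
      IsInexactADMM F B σ τ ε u z lam →
      ∑' k, kktResidual F B (u (k + 1)) (z (k + 1)) (lam (k + 1))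
        ≤ ENNReal.ofReal (C ‖z 0 - u'‖ ‖lam 0 - lam'‖) := by
  obtain ⟨C, hC⟩ := exists_dissipation_sum_le (H := H) hσ hτ hτ' hε
  set κ := 4 + 4 * ((1 - τ) * σ) ^ 2 + 3 * σ ^ 2
  have hκ : 0 ≤ κ := by positivity
  refine ⟨fun s t => κ * ((∑' k, ε k) ^ 2 + C s t),
    fun {F B μ u z lam u' lam'} hμ hF hB hKKT h =>
      ENNReal.tsum_le_of_sum_range_le fun N => ?_⟩
  have hε0 := h.tolerance_nonneg
  calc ∑ k ∈ Finset.range N, kktResidual F B (u (k + 1)) (z (k + 1)) (lam (k + 1))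
      ≤ ∑ k ∈ Finset.range N, ENNReal.ofReal (κ * (ε k ^ 2 + dissipation μ u' u z k)) :=
        Finset.sum_le_sum fun k _ => h.kktResidual_succ_le hμ u' k
    _ = ENNReal.ofReal (κ * (∑ k ∈ Finset.range N, ε k ^ 2
          + ∑ k ∈ Finset.range N, dissipation μ u' u z k)) := by
        rw [← ENNReal.ofReal_sum_of_nonneg fun k _ => mul_nonneg hκ
          (add_nonneg (sq_nonneg _) (dissipation_nonneg hμ u' u z k)),
          ← Finset.mul_sum, Finset.sum_add_distrib]
    _ ≤ ENNReal.ofReal (κ * ((∑' k, ε k) ^ 2 + C ‖z 0 - u'‖ ‖lam 0 - lam'‖)) := by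
        gcongr
        · refine (Finset.sum_sq_le_sq_sum_of_nonneg fun k _ => hε0 k).trans ?_
          gcongr
          exacts [Finset.sum_nonneg fun k _ => hε0 k, hε.sum_le_tsum _ fun k _ => hε0 k]
        · exact hC hμ hF hB hKKT h N

end IsInexactADMM

end ADMM

section ReducedCost

variable {n : ℕ} {Ω : Set (E n)} {P : Problem Ω} {Y : L2 Ω →L[ℝ] H10 Ω}

/-- The embedding `toHm1` as a continuous linear map. -/
def toHm1L : L2 Ω →L[ℝ] Hm1 Ω :=
  (ContinuousLinearMap.precomp ℝ toL2).comp (innerSL ℝ)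

/-- `Y` is the restriction of the solution operator `S` to `L²(Ω)`. By symmetry of the bilinear
form it is the restriction of `S*` as well, and symmetric in the inner product of `L²(Ω)`. -/
structure Problem.IsControlToState (P : Problem Ω) (Y : L2 Ω →L[ℝ] H10 Ω) : Prop where
  state_eq : ∀ u, P.state u = Y (u + P.yc)
  adjState_eq : ∀ y, P.adjState y = Y (P.yd - toL2 y)
  inner_symm : ∀ v w : L2 Ω, ⟪toL2 (Y v), w⟫_ℝ = ⟪v, toL2 (Y w)⟫_ℝ

theorem Problem.Admissible.exists_isControlToState (hP : P.Admissible) (hn : 0 < n)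
    (hΩ : Bornology.IsBounded Ω) : ∃ Y, P.IsControlToState Y := by
  have hco := hP.isCoercive_formL hn hΩ
  refine ⟨(laxMilgram hco).comp toHm1L, fun u => hP.S_eq_laxMilgram hco _,
    fun y => hP.Sadj_eq_laxMilgram hco _, fun v w => ?_⟩
  rw [real_inner_comm]
  exact apply_laxMilgram_comm hco hP.formL_comm (toHm1 w) (toHm1 v)

namespace Problem.IsControlToState

theorem continuous_state (hY : P.IsControlToState Y) : Continuous P.state := by
  rw [funext hY.state_eq]
  fun_prop

theorem continuous_adjState (hY : P.IsControlToState Y) : Continuous P.adjState := by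
  rw [funext hY.adjState_eq]
  fun_prop

theorem hasGradientAt_f (hY : P.IsControlToState Y) (u : L2 Ω) :
    HasGradientAt P.f ((P.α / 2) • u - toL2 (P.adjState (P.state u))) u := by
  have hf : P.f = fun u => 1 / 2 * ‖toL2 (Y (u + P.yc)) - P.yd‖ ^ 2 + P.α / 4 * ‖u‖ ^ 2 := by
    funext u
    rw [f, hY.state_eq]
  have htracking : HasFDerivAt (fun u => toL2 (Y (u + P.yc)) - P.yd) (toL2.comp Y) u :=
    ((toL2.comp Y).hasFDerivAt.comp u ((hasFDerivAt_id u).add_const P.yc)).sub_const P.yd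
  rw [hasGradientAt_iff_hasFDerivAt, hf]
  refine ((htracking.norm_sq.const_mul (1 / 2)).add
    ((hasFDerivAt_id u).norm_sq.const_mul (P.α / 4))).congr_fderiv ?_
  ext v
  simp [hY.state_eq, hY.adjState_eq, hY.inner_symm]
  ring

theorem gradient_f (hY : P.IsControlToState Y) (u : L2 Ω) :
    gradient P.f u = (P.α / 2) • u - toL2 (P.adjState (P.state u)) :=
  (hY.hasGradientAt_f u).gradient

theorem continuous_gradient_f (hY : P.IsControlToState Y) : Continuous (gradient P.f) := by
  rw [funext hY.gradient_f]
  exact (continuous_const_smul _).sub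
    (toL2.continuous.comp (hY.continuous_adjState.comp hY.continuous_state))

theorem isStronglyMonotone_gradient_f (hY : P.IsControlToState Y) :
    IsStronglyMonotone (P.α / 2) (gradient P.f) := by
  intro u v
  have hdiff : gradient P.f u - gradient P.f v
      = (P.α / 2) • (u - v) + toL2 (Y (toL2 (Y (u - v)))) := by
    simp only [hY.gradient_f, hY.state_eq, hY.adjState_eq, map_add, map_sub]
    module
  rw [hdiff, inner_add_left, real_inner_smul_left, real_inner_self_eq_norm_sq, hY.inner_symm,
    real_inner_self_eq_norm_sq]
  exact le_add_of_nonneg_right (sq_nonneg _)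

end Problem.IsControlToState

end ReducedCost

section Sparsity

variable {n : ℕ} {Ω : Set (E n)} {P : Problem Ω}

theorem convexOn_normL1 [IsFiniteMeasure (volume.restrict Ω)] :
    ConvexOn ℝ univ (normL1 : L2 Ω → ℝ) := by
  have hint (z : L2 Ω) : Integrable (fun x => |z x|) (volume.restrict Ω) :=
    ((Lp.memLp z).integrable one_le_two).abs
  refine ⟨convex_univ, fun z _ w _ s t hs ht _ => ?_⟩
  calc normL1 (s • z + t • w) ≤ ∫ x in Ω, (s * |z x| + t * |w x|) := by
        refine integral_mono_ae (hint _) (((hint z).const_mul s).add ((hint w).const_mul t)) ?_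
        filter_upwards [Lp.coeFn_add (s • z) (t • w), Lp.coeFn_smul s z, Lp.coeFn_smul t w]
          with x hadd hsz htw
        simp only [hadd, Pi.add_apply, hsz, htw, Pi.smul_apply, smul_eq_mul]
        simpa only [abs_mul, abs_of_nonneg hs, abs_of_nonneg ht] using
          abs_add_le (s * z x) (t * w x)
    _ = s • normL1 z + t • normL1 w := by
        rw [integral_add ((hint z).const_mul s) ((hint w).const_mul t), integral_const_mul,
          integral_const_mul]
        rfl

namespace Problem

theorem convex_Uad (P : Problem Ω) : Convex ℝ P.Uad := by
  intro z hz w hw s t hs ht hst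
  change ∀ᵐ x ∂_, _
  filter_upwards [hz, hw, Lp.coeFn_add (s • z) (t • w), Lp.coeFn_smul s z, Lp.coeFn_smul t w]
    with x hzx hwx hadd hsz htw
  rw [hadd, Pi.add_apply, hsz, htw]
  exact convex_Icc P.lo P.hi hzx hwx hs ht hst

theorem Admissible.zero_mem_Uad (hP : P.Admissible) : (0 : L2 Ω) ∈ P.Uad := by
  change ∀ᵐ x ∂_, _
  filter_upwards [Lp.coeFn_zero ℝ 2 (volume.restrict Ω)] with x hx
  rw [hx]
  exact ⟨hP.lo_neg.le, hP.hi_pos.le⟩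

/-- The finite part of the extended-real-valued function `Problem.g`. -/
def gFin (P : Problem Ω) (z : L2 Ω) : ℝ := P.α / 4 * ‖z‖ ^ 2 + P.β * normL1 z

theorem g_of_mem {z : L2 Ω} (hz : z ∈ P.Uad) : P.g z = (P.gFin z : EReal) := by
  simp [g, gFin, hz]

theorem g_of_notMem {z : L2 Ω} (hz : z ∉ P.Uad) : P.g z = ⊤ := by
  rw [g, if_neg hz, EReal.coe_add_top]

theorem Admissible.convexOn_gFin [IsFiniteMeasure (volume.restrict Ω)] (hP : P.Admissible) :
    ConvexOn ℝ P.Uad P.gFin := by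
  have hnorm_sq : ConvexOn ℝ P.Uad fun z : L2 Ω => ‖z‖ ^ 2 :=
    (convexOn_norm P.convex_Uad).pow (fun _ _ => norm_nonneg _) 2
  have hα : 0 ≤ P.α / 4 := (div_pos hP.α_pos four_pos).le
  exact (hnorm_sq.smul hα).add
    ((convexOn_normL1.subset (subset_univ _) P.convex_Uad).smul hP.β_pos.le)

theorem Admissible.mem_subdiffG_iff (hP : P.Admissible) {z ξ : L2 Ω} :
    ξ ∈ P.subdiffG z ↔ z ∈ P.Uad ∧ ξ ∈ subgradientsOn P.Uad P.gFin z := by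
  refine ⟨fun h => ?_, fun ⟨hz, h⟩ w => ?_⟩
  · have hz : z ∈ P.Uad := by
      by_contra hz
      have hzero := h 0
      rw [g_of_notMem hz, EReal.top_add_coe, top_le_iff, g_of_mem hP.zero_mem_Uad] at hzero
      exact EReal.coe_ne_top _ hzero
    refine ⟨hz, fun w hw => ?_⟩
    have hw_ineq := h w
    rw [g_of_mem hz, g_of_mem hw] at hw_ineq
    exact_mod_cast hw_ineq
  · by_cases hw : w ∈ P.Uad
    · rw [g_of_mem hz, g_of_mem hw]
      exact_mod_cast h w hw
    · rw [g_of_notMem hw]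
      exact le_top

theorem Admissible.isMonotoneOperator_subdiffG (hP : P.Admissible) :
    IsMonotoneOperator P.subdiffG := by
  intro z w ξ ζ hξ hζ
  obtain ⟨hz, hξ⟩ := hP.mem_subdiffG_iff.1 hξ
  obtain ⟨hw, hζ⟩ := hP.mem_subdiffG_iff.1 hζ
  exact inner_nonneg_of_mem_subgradientsOn hz hw hξ hζ

end Problem

end Sparsity

section Subproblems

theorem hasFDerivAt_inner_add_norm_sq {H : Type*} [NormedAddCommGroup H] [InnerProductSpace ℝ H]
    (σ : ℝ) (l x : H) :
    HasFDerivAt (fun x => ⟪l, x⟫_ℝ + σ / 2 * ‖x‖ ^ 2) (innerSL ℝ (l + σ • x)) x := by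
  refine ((innerSL ℝ l).hasFDerivAt.add
    ((hasFDerivAt_id x).norm_sq.const_mul (σ / 2))).congr_fderiv ?_
  ext v
  simp
  ring

namespace Problem

variable {n : ℕ} {Ω : Set (E n)} {P : Problem Ω} {Y : L2 Ω →L[ℝ] H10 Ω} {σ τ : ℝ} {ε : ℕ → ℝ}

theorem augLag_of_mem {u z lam : L2 Ω} (hz : z ∈ P.Uad) :
    P.augLag σ u z lam =
      ((P.f u + P.gFin z + (⟪lam, u - z⟫_ℝ + σ / 2 * ‖u - z‖ ^ 2) : ℝ) : EReal) := by
  rw [augLag, g_of_mem hz]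
  push_cast
  rfl

theorem augLag_of_notMem {u z lam : L2 Ω} (hz : z ∉ P.Uad) : P.augLag σ u z lam = ⊤ := by
  rw [augLag, g_of_notMem hz, EReal.coe_add_top, EReal.top_add_coe]

theorem Admissible.mem_Uad_of_isMinOn_augLag (hP : P.Admissible) {u z lam : L2 Ω}
    (hmin : IsMinOn (fun w => P.augLag σ u w lam) univ z) : z ∈ P.Uad := by
  by_contra hz
  have hzero : P.augLag σ u z lam ≤ P.augLag σ u 0 lam := hmin (mem_univ _)
  rw [augLag_of_notMem hz, augLag_of_mem hP.zero_mem_Uad, top_le_iff] at hzero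
  exact EReal.coe_ne_top _ hzero

theorem Admissible.mem_subdiffG_of_isMinOn_augLag [IsFiniteMeasure (volume.restrict Ω)]
    (hP : P.Admissible) {u z lam : L2 Ω}
    (hmin : IsMinOn (fun w => P.augLag σ u w lam) univ z) :
    lam + σ • (u - z) ∈ P.subdiffG z := by
  have hz := hP.mem_Uad_of_isMinOn_augLag hmin
  have hmin_fin :
      IsMinOn (fun w => P.gFin w + (⟪lam, u - w⟫_ℝ + σ / 2 * ‖u - w‖ ^ 2)) P.Uad z := by
    intro w hw
    have hzw : P.augLag σ u z lam ≤ P.augLag σ u w lam := hmin (mem_univ w)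
    rw [augLag_of_mem hz, augLag_of_mem hw, EReal.coe_le_coe_iff, add_assoc, add_assoc] at hzw
    exact le_of_add_le_add_left hzw
  have hderiv : HasFDerivAt (fun w => ⟪lam, u - w⟫_ℝ + σ / 2 * ‖u - w‖ ^ 2)
      (innerSL ℝ (-(lam + σ • (u - z)))) z := by
    refine ((hasFDerivAt_inner_add_norm_sq σ lam (u - z)).comp z
      ((hasFDerivAt_id z).const_sub u)).congr_fderiv ?_
    ext v
    simp
  rw [hP.mem_subdiffG_iff, ← neg_neg (lam + _)]
  exact ⟨hz, neg_mem_subgradientsOn_of_isMinOn hP.convexOn_gFin hz hderiv hmin_fin⟩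

theorem gradient_f_add_eq_of_isMinOn_augLag {u z lam δ : L2 Ω}
    (hf : DifferentiableAt ℝ P.f u) (hz : z ∈ P.Uad)
    (hmin : IsMinOn (fun v => P.augLag σ v z lam - ((⟪δ, v⟫_ℝ : ℝ) : EReal)) univ u) :
    gradient P.f u + lam + σ • (u - z) = δ := by
  let ψ (v : L2 Ω) : ℝ :=
    P.f v + P.gFin z + (⟪lam, v - z⟫_ℝ + σ / 2 * ‖v - z‖ ^ 2) - ⟪δ, v⟫_ℝ
  have hψ : IsMinOn ψ univ u := by
    intro v _
    have huv : P.augLag σ u z lam - ((⟪δ, u⟫_ℝ : ℝ) : EReal) ≤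
      P.augLag σ v z lam - ((⟪δ, v⟫_ℝ : ℝ) : EReal) := hmin (mem_univ v)
    rwa [augLag_of_mem hz, augLag_of_mem hz, ← EReal.coe_sub, ← EReal.coe_sub,
      EReal.coe_le_coe_iff] at huv
  have hderiv : HasFDerivAt ψ (innerSL ℝ (gradient P.f u + (lam + σ • (u - z)) - δ)) u := by
    refine (((hf.hasGradientAt.hasFDerivAt.add_const (P.gFin z)).add
      ((hasFDerivAt_inner_add_norm_sq σ lam (u - z)).comp u
        ((hasFDerivAt_id u).sub_const z))).sub (innerSL ℝ δ).hasFDerivAt).congr_fderiv ?_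
    ext v
    simp
  have hzero : gradient P.f u + (lam + σ • (u - z)) - δ = 0 := inner_self_eq_zero.1 <|
    DFunLike.congr_fun ((hψ.isLocalMin univ_mem).hasFDerivAt_eq_zero hderiv) _
  rw [add_assoc, sub_eq_zero.1 hzero]

theorem IsADMM.mem_Uad (hP : P.Admissible) {u z lam : ℕ → L2 Ω}
    (h : P.IsADMM σ τ ε u z lam) : ∀ k, z k ∈ P.Uad
  | 0 => h.z_init
  | k + 1 => hP.mem_Uad_of_isMinOn_augLag (h.z_step k)

theorem IsADMM.isInexactADMM [IsFiniteMeasure (volume.restrict Ω)] (hP : P.Admissible)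
    (hY : P.IsControlToState Y) {u z lam : ℕ → L2 Ω} (h : P.IsADMM σ τ ε u z lam) :
    IsInexactADMM (gradient P.f) P.subdiffG σ τ ε u z lam where
  norm_uError_le k := by
    obtain ⟨δ, hδ, hmin⟩ := h.u_step k
    rwa [uError, gradient_f_add_eq_of_isMinOn_augLag (hY.hasGradientAt_f _).differentiableAt
      (h.mem_Uad hP k) hmin]
  z_step k := hP.mem_subdiffG_of_isMinOn_augLag (h.z_step k)
  lam_step := h.lam_step

theorem IsKKT.mem_subdiffG (hP : P.Admissible) {y p : H10 Ω} {u z lam : L2 Ω}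
    (h : P.IsKKT y u z p lam) : lam ∈ P.subdiffG z := by
  refine hP.mem_subdiffG_iff.2 ⟨h.z_mem, fun w hw => ?_⟩
  have hvar := h.var_ineq w hw
  rw [inner_sub_left, real_inner_smul_left] at hvar
  have hexpand : ‖w‖ ^ 2 = ‖z‖ ^ 2 + 2 * ⟪z, w - z⟫_ℝ + ‖w - z‖ ^ 2 := by
    rw [← norm_add_sq_real, add_sub_cancel]
  have hquad : 0 ≤ P.α / 4 * ‖w - z‖ ^ 2 :=
    mul_nonneg (div_pos hP.α_pos four_pos).le (sq_nonneg _)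
  simp only [gFin, hexpand]
  linarith

theorem IsKKT.isKKTPair (hP : P.Admissible) (hY : P.IsControlToState Y) {y p : H10 Ω}
    {u z lam : L2 Ω} (h : P.IsKKT y u z p lam) :
    IsKKTPair (gradient P.f) P.subdiffG u lam where
  add_eq_zero := by rw [hY.gradient_f, ← h.state_eq, ← h.adj_eq, h.grad_eq]
  mem := h.u_eq_z ▸ h.mem_subdiffG hP

end Problem

end Subproblems

end SparseControl

end

theorem theorem2p3_general {n : ℕ} (hn : 0 < n) {Ω : Set (E n)} (hΩ : Bornology.IsBounded Ω)
    {σ τ : ℝ} (hσ : 0 < σ) (hτ : 0 < τ) (hτ' : τ < Real.goldenRatio) {ε : ℕ → ℝ}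
    (hε : Summable ε) :
    ∃ C : L2 Ω × L2 Ω × L2 Ω → L2 Ω × L2 Ω × L2 Ω → ℝ,
      ∀ P : Problem Ω, P.Admissible →
      ∀ (y' : H10 Ω) (u' z' : L2 Ω) (p' : H10 Ω) (lam' : L2 Ω), P.IsKKT y' u' z' p' lam' →
      ∀ u z lam : ℕ → L2 Ω, P.IsADMM σ τ ε u z lam →
      ∀ y p : ℕ → H10 Ω, (∀ k, y k = P.state (u k)) → (∀ k, p k = P.adjState (y k)) →
        Tendsto (fun k => ‖u k - u'‖ + ‖z k - z'‖ + ‖lam k - lam'‖) atTop (𝓝 0) ∧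
        Tendsto (fun k => ‖y k - y'‖ + ‖p k - p'‖) atTop (𝓝 0) ∧
        (∀ k : ℕ, 1 ≤ k →
          (Finset.Icc 1 k).inf (fun i => P.R (u i) (z i) (lam i))
            ≤ ENNReal.ofReal (C (u 0, z 0, lam 0) (u', z', lam') / k)) ∧
        Tendsto (fun k : ℕ => (k : ℝ≥0∞) *
          (Finset.Icc 1 k).inf (fun i => P.R (u i) (z i) (lam i))) atTop (𝓝 0) := by
  have : IsFiniteMeasure (volume.restrict Ω) := isFiniteMeasure_restrict.2 hΩ.measure_lt_top.ne
  obtain ⟨C, hC⟩ := IsInexactADMM.exists_tsum_kktResidual_le (H := L2 Ω) hσ hτ hτ' hε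
  refine ⟨fun s t => C ‖s.2.1 - t.1‖ ‖s.2.2 - t.2.2‖,
    fun P hP y' u' z' p' lam' hKKT u z lam hADMM y p hy hp => ?_⟩
  obtain ⟨Y, hY⟩ := hP.exists_isControlToState hn hΩ
  have hα : 0 < P.α / 2 := half_pos hP.α_pos
  have hF := hY.isStronglyMonotone_gradient_f
  have hB := hP.isMonotoneOperator_subdiffG
  have hpair := hKKT.isKKTPair hP hY
  have hinexact := hADMM.isInexactADMM hP hY
  obtain ⟨hu, hz, hlam⟩ := hinexact.tendsto hσ hτ hτ' hε hα hF hY.continuous_gradient_f.continuousAt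
    hB hpair
  have hylim : Tendsto y atTop (𝓝 y') := by
    rw [funext hy, hKKT.state_eq]
    exact (hY.continuous_state.tendsto u').comp hu
  have hplim : Tendsto p atTop (𝓝 p') := by
    rw [funext hp, hKKT.adj_eq]
    exact (hY.continuous_adjState.tendsto y').comp hylim
  have hsum := hC hα.le hF hB hpair hinexact
  rw [tendsto_iff_norm_sub_tendsto_zero] at hu hz hlam hylim hplim
  refine ⟨?_, by simpa only [add_zero] using hylim.add hplim,
    fun k hk => inf_Icc_le_ofReal_div hsum hk,
    tendsto_mul_inf_Icc (ne_top_of_le_ne_top ENNReal.ofReal_ne_top hsum)⟩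
  rw [← hKKT.u_eq_z]
  simpa only [add_zero] using (hu.add hz).add hlam

theorem theorem2p3 {n : ℕ} (hn : n = 2 ∨ n = 3) (Ω : Set (E n))
    (hΩ_open : IsOpen Ω) (hΩ_bdd : Bornology.IsBounded Ω) (hΩ_conv : Convex ℝ Ω)
    (σ τ : ℝ) (hσ : 0 < σ) (hτ : 0 < τ) (hτ' : τ < (1 + √5) / 2)
    (ε : ℕ → ℝ) (hε : ∀ k, 0 ≤ ε k) (hε_sum : Summable ε) :
    -- `C` is a function of the initial point and of the optimal solution only
    ∃ C : L2 Ω × L2 Ω × L2 Ω → L2 Ω × L2 Ω × L2 Ω → ℝ,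
      ∀ P : Problem Ω, P.Admissible →
      ∀ (y' : H10 Ω) (u' z' : L2 Ω) (p' : H10 Ω) (lam' : L2 Ω), P.IsKKT y' u' z' p' lam' →
      ∀ u z lam : ℕ → L2 Ω, P.IsADMM σ τ ε u z lam →
      ∀ y p : ℕ → H10 Ω, (∀ k, y k = P.state (u k)) → (∀ k, p k = P.adjState (y k)) →
        Tendsto (fun k => ‖u k - u'‖ + ‖z k - z'‖ + ‖lam k - lam'‖) atTop (𝓝 0) ∧
        Tendsto (fun k => ‖y k - y'‖ + ‖p k - p'‖) atTop (𝓝 0) ∧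
        (∀ k : ℕ, 1 ≤ k →
          (Finset.Icc 1 k).inf (fun i => P.R (u i) (z i) (lam i))
            ≤ ENNReal.ofReal (C (u 0, z 0, lam 0) (u', z', lam') / k)) ∧
        Tendsto (fun k : ℕ => (k : ℝ≥0∞) *
          (Finset.Icc 1 k).inf (fun i => P.R (u i) (z i) (lam i))) atTop (𝓝 0) := by
  exact theorem2p3_general (by omega) hΩ_bdd hσ hτ hτ' hε_sum
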